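/- Let $0<q<1$, $q=e^{-h/2}$. **The quantum algebra.** Let $U_q\mathfrak{su}(1,1)$ be the unital complex algebra generated by $H$, $X^{\pm}$ and $k^{\pm1}$, where $k=e^{-hH/4}=q^{H/2}$, with the relations $kk^{-1}=k^{-1}k=1$, $kH=Hk$, $kX^{\pm}=q^{\pm1}X^{\pm}k$, $[H,X^{\pm}]=\pm2X^{\pm}$ and $[X^+,X^-]=\frac{k^2-k^{-2}}{q-q^{-1}}$. Its counit is given by $\varepsilon(H)=\varepsilon(X^{\pm})=0$, $\varepsilon(k^{\pm1})=1$. **Polynomials.** Let $\mathrm{Pol}(\widetilde X)_q$ be the unital complex algebra with generators $t_{11},t_{12},t_{21},t_{22}$ and relations $$t_{11}t_{12}=qt_{12}t_{11},\quad t_{21}t_{22}=qt_{22}t_{21},\quad t_{11}t_{21}=qt_{21}t_{11},\quad t_{12}t_{22}=qt_{22}t_{12},\quad t_{12}t_{21}=t_{21}t_{12},$$ $$t_{11}t_{22}-t_{22}t_{11}=(q-q^{-1})t_{12}t_{21},\qquad t_{11}t_{22}-qt_{12}t_{21}=1,$$ and put $t_{11}^*=-t_{22}$, $t_{12}^*=-qt_{21}$,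 $x=t_{12}t_{12}^*$. The algebra $U_q\mathfrak{su}(1,1)$ acts on it by $Ht_{i1}=t_{i1}$, $Ht_{i2}=-t_{i2}$, $X^+t_{i1}=0$, $X^+t_{i2}=t_{i1}$, $X^-t_{i1}=t_{i2}$, $X^-t_{i2}=0$, $k^{\pm1}t_{i1}=q^{\pm1/2}t_{i1}$, $k^{\pm1}t_{i2}=q^{\mp1/2}t_{i2}$ ($i=1,2$), by $k^{\pm1}(fg)=(k^{\pm1}f)(k^{\pm1}g)$, $H(fg)=(Hf)g+f(Hg)$, $X^{\pm}(fg)=(X^{\pm}f)(k^{-1}g)+(kf)(X^{\pm}g)$, and by $\xi 1=\varepsilon(\xi)1$. **Distributions and finite functions.** Let $M''=\{(i_1,i_2,j_1,j_2)\in\mathbb Z_+^4 : i_1j_1=i_2j_2=0\}$. Let $D(\widetilde X)_q'$ be the space of formal series $$f=\sum_{(i_1,i_2,j_1,j_2)\in M''}t_{11}^{i_1}t_{12}^{i_2}\,\psi_{i_1i_2j_1j_2}(x)\,t_{12}^{*j_2}t_{11}^{*j_1}$$ whose coefficients are arbitrary functions $\psi_{i_1i_2j_1j_2}:q^{-2\mathbb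 Z_+}\to\mathbb C$, with the topology of pointwise convergence of the coefficients. The finite sums of this form with polynomial coefficients are the elements of $\mathrm{Pol}(\widetilde X)_q\subset D(\widetilde X)_q'$. Let $D(\widetilde X)_q\subset D(\widetilde X)_q'$ be the subspace of those $f$ for which only finitely many of the numbers $\psi_{i_1i_2j_1j_2}(q^{-2m})$ (with $(i_1,i_2,j_1,j_2)\in M''$, $m\in\mathbb Z_+$) are non-zero. **Proposition 3.2.** The action of $U_q\mathfrak{su}(1,1)$ on $\mathrm{Pol}(\widetilde X)_q$ extends to $D(\widetilde X)_q'$ as an action by continuous linear operators in exactly one way. This extended action preserves $D(\widetilde X)_q$, and with respect to it the linear functional $$\nu:D(\widetilde X)_q\to\mathbb C,\qquad \nu(f)=(1-q^2)\sum_{m=0}^{\infty}\psi_{0000}(q^{-2m})\,q^{-2m},$$ is a $U_q\mathfrak{su}(1,1)$-invariant integral, that is, $$\nu(\xi f)=\varepsilon(\xi)\,\nu(f)\qquad\text{for all }\xi\in U_q\mathfrak{su}(1,1),\ f\in D(\widetilde X)_q.$$ -/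

import Mathlib

noncomputable section

namespace QuantumSU11

/-! ### The quantum universal enveloping algebra `U_q su(1,1)` -/

/-- Generators of `U_q sl_2`: `H`, `X⁺`, `X⁻`, and `k = e^{-hH/4} = q^{H/2}` with its inverse
(here `q = e^{-h/2}`). -/
inductive UGen
  | H | Xp | Xm | k | kinv

/-- The defining relations of `U_q sl_2`: `[H, X^±] = ±2 X^±`,
`[X⁺, X⁻] = sh(hH/2) / sh(h/2) = (k² - k⁻²) / (q - q⁻¹)`, and the commutation relations of
`k = q^{H/2}` with the other generators. -/
inductive URel (q : ℝ) : FreeAlgebra ℂ UGen → FreeAlgebra ℂ UGen → Prop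
  | k_kinv : URel q (FreeAlgebra.ι ℂ UGen.k * FreeAlgebra.ι ℂ UGen.kinv) 1
  | kinv_k : URel q (FreeAlgebra.ι ℂ UGen.kinv * FreeAlgebra.ι ℂ UGen.k) 1
  | k_H : URel q (FreeAlgebra.ι ℂ UGen.k * FreeAlgebra.ι ℂ UGen.H)
      (FreeAlgebra.ι ℂ UGen.H * FreeAlgebra.ι ℂ UGen.k)
  | k_Xp : URel q (FreeAlgebra.ι ℂ UGen.k * FreeAlgebra.ι ℂ UGen.Xp)
      ((q : ℂ) • (FreeAlgebra.ι ℂ UGen.Xp * FreeAlgebra.ι ℂ UGen.k))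
  | k_Xm : URel q (FreeAlgebra.ι ℂ UGen.k * FreeAlgebra.ι ℂ UGen.Xm)
      ((q : ℂ)⁻¹ • (FreeAlgebra.ι ℂ UGen.Xm * FreeAlgebra.ι ℂ UGen.k))
  | H_Xp : URel q
      (FreeAlgebra.ι ℂ UGen.H * FreeAlgebra.ι ℂ UGen.Xp
        - FreeAlgebra.ι ℂ UGen.Xp * FreeAlgebra.ι ℂ UGen.H)
      ((2 : ℂ) • FreeAlgebra.ι ℂ UGen.Xp)
  | H_Xm : URel q
      (FreeAlgebra.ι ℂ UGen.H * FreeAlgebra.ι ℂ UGen.Xm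
        - FreeAlgebra.ι ℂ UGen.Xm * FreeAlgebra.ι ℂ UGen.H)
      ((-2 : ℂ) • FreeAlgebra.ι ℂ UGen.Xm)
  | Xp_Xm : URel q
      (FreeAlgebra.ι ℂ UGen.Xp * FreeAlgebra.ι ℂ UGen.Xm
        - FreeAlgebra.ι ℂ UGen.Xm * FreeAlgebra.ι ℂ UGen.Xp)
      (((q : ℂ) - (q : ℂ)⁻¹)⁻¹ •
        (FreeAlgebra.ι ℂ UGen.k ^ 2 - FreeAlgebra.ι ℂ UGen.kinv ^ 2))

/-- The algebra `U_q su(1,1)` (that is, `U_q sl_2`; its involution plays no role for the notion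
of an invariant integral). -/
abbrev Uq (q : ℝ) : Type := RingQuot (URel q)

/-- The values of the counit on generators. -/
def counitGen : UGen → ℂ
  | .H => 0
  | .Xp => 0
  | .Xm => 0
  | .k => 1
  | .kinv => 1

/-- The counit `ε : U_q su(1,1) → ℂ`, with `ε(H) = ε(X^±) = 0` and `ε(k^{±1}) = 1`. -/
def counit (q : ℝ) : Uq q →ₐ[ℂ] ℂ :=
  RingQuot.liftAlgHom ℂ ⟨FreeAlgebra.lift ℂ counitGen, by
    intro x y h
    cases h <;> simp only [map_mul, map_sub, map_smul, map_pow, map_one,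
      FreeAlgebra.lift_ι_apply, counitGen] <;> simp⟩

/-- A linear functional `μ` on a `U_q su(1,1)`-module (given by a representation `σ`) is an
invariant integral if it is a morphism to the trivial module. -/
def IsInvariantIntegral {q : ℝ} {M : Type*} [AddCommGroup M] [Module ℂ M]
    (σ : Uq q →ₐ[ℂ] Module.End ℂ M) (μ : M →ₗ[ℂ] ℂ) : Prop :=
  ∀ (ξ : Uq q) (f : M), μ (σ ξ f) = counit q ξ * μ f

/-! ### The algebra of polynomials on the quantum principal homogeneous space -/

/-- The generators `t_{ij}` of `ℂ[SL_2]_q`. -/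
inductive TGen
  | t11 | t12 | t21 | t22

/-- The defining relations of `ℂ[SL_2]_q` for four elements of a complex algebra. -/
structure IsQuantumSL2 (q : ℝ) {A : Type*} [Ring A] [Algebra ℂ A] (t : TGen → A) : Prop where
  r1 : t .t11 * t .t12 = (q : ℂ) • (t .t12 * t .t11)
  r2 : t .t21 * t .t22 = (q : ℂ) • (t .t22 * t .t21)
  r3 : t .t11 * t .t21 = (q : ℂ) • (t .t21 * t .t11)
  r4 : t .t12 * t .t22 = (q : ℂ) • (t .t22 * t .t12)
  r5 : t .t12 * t .t21 = t .t21 * t .t12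
  r6 : t .t11 * t .t22 - t .t22 * t .t11 = ((q : ℂ) - (q : ℂ)⁻¹) • (t .t12 * t .t21)
  r7 : t .t11 * t .t22 - (q : ℂ) • (t .t12 * t .t21) = 1

/-- The same relations, as a relation on the free algebra on the `t_{ij}`. -/
inductive TRel (q : ℝ) : FreeAlgebra ℂ TGen → FreeAlgebra ℂ TGen → Prop
  | r1 : TRel q (FreeAlgebra.ι ℂ TGen.t11 * FreeAlgebra.ι ℂ TGen.t12)
      ((q : ℂ) • (FreeAlgebra.ι ℂ TGen.t12 * FreeAlgebra.ι ℂ TGen.t11))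
  | r2 : TRel q (FreeAlgebra.ι ℂ TGen.t21 * FreeAlgebra.ι ℂ TGen.t22)
      ((q : ℂ) • (FreeAlgebra.ι ℂ TGen.t22 * FreeAlgebra.ι ℂ TGen.t21))
  | r3 : TRel q (FreeAlgebra.ι ℂ TGen.t11 * FreeAlgebra.ι ℂ TGen.t21)
      ((q : ℂ) • (FreeAlgebra.ι ℂ TGen.t21 * FreeAlgebra.ι ℂ TGen.t11))
  | r4 : TRel q (FreeAlgebra.ι ℂ TGen.t12 * FreeAlgebra.ι ℂ TGen.t22)
      ((q : ℂ) • (FreeAlgebra.ι ℂ TGen.t22 * FreeAlgebra.ι ℂ TGen.t12))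
  | r5 : TRel q (FreeAlgebra.ι ℂ TGen.t12 * FreeAlgebra.ι ℂ TGen.t21)
      (FreeAlgebra.ι ℂ TGen.t21 * FreeAlgebra.ι ℂ TGen.t12)
  | r6 : TRel q
      (FreeAlgebra.ι ℂ TGen.t11 * FreeAlgebra.ι ℂ TGen.t22
        - FreeAlgebra.ι ℂ TGen.t22 * FreeAlgebra.ι ℂ TGen.t11)
      (((q : ℂ) - (q : ℂ)⁻¹) • (FreeAlgebra.ι ℂ TGen.t12 * FreeAlgebra.ι ℂ TGen.t21))
  | r7 : TRel q
      (FreeAlgebra.ι ℂ TGen.t11 * FreeAlgebra.ι ℂ TGen.t22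
        - (q : ℂ) • (FreeAlgebra.ι ℂ TGen.t12 * FreeAlgebra.ι ℂ TGen.t21)) 1

/-- `Pol(X̃)_q`, which is `ℂ[SL_2]_q` as an algebra. -/
abbrev Pol (q : ℝ) : Type := RingQuot (TRel q)

/-- The generators as elements of `Pol(X̃)_q`. -/
def tPol (q : ℝ) (g : TGen) : Pol q := RingQuot.mkAlgHom ℂ (TRel q) (FreeAlgebra.ι ℂ g)

theorem isQuantumSL2_tPol (q : ℝ) : IsQuantumSL2 q (tPol q) where
  r1 := by simpa only [tPol, map_mul, map_smul] using
    RingQuot.mkAlgHom_rel ℂ (TRel.r1 (q := q))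
  r2 := by simpa only [tPol, map_mul, map_smul] using
    RingQuot.mkAlgHom_rel ℂ (TRel.r2 (q := q))
  r3 := by simpa only [tPol, map_mul, map_smul] using
    RingQuot.mkAlgHom_rel ℂ (TRel.r3 (q := q))
  r4 := by simpa only [tPol, map_mul, map_smul] using
    RingQuot.mkAlgHom_rel ℂ (TRel.r4 (q := q))
  r5 := by simpa only [tPol, map_mul, map_smul] using
    RingQuot.mkAlgHom_rel ℂ (TRel.r5 (q := q))
  r6 := by simpa only [tPol, map_mul, map_sub, map_smul] using
    RingQuot.mkAlgHom_rel ℂ (TRel.r6 (q := q))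
  r7 := by simpa only [tPol, map_mul, map_sub, map_smul, map_one] using
    RingQuot.mkAlgHom_rel ℂ (TRel.r7 (q := q))

/-- The universal property of `ℂ[SL_2]_q`. -/
def polLift {q : ℝ} {A : Type*} [Ring A] [Algebra ℂ A] (t : TGen → A)
    (ht : IsQuantumSL2 q t) : Pol q →ₐ[ℂ] A :=
  RingQuot.liftAlgHom ℂ ⟨FreeAlgebra.lift ℂ t, by
    intro x y h
    cases h
    · simpa only [map_mul, map_smul, FreeAlgebra.lift_ι_apply] using ht.r1
    · simpa only [map_mul, map_smul, FreeAlgebra.lift_ι_apply] using ht.r2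
    · simpa only [map_mul, map_smul, FreeAlgebra.lift_ι_apply] using ht.r3
    · simpa only [map_mul, map_smul, FreeAlgebra.lift_ι_apply] using ht.r4
    · simpa only [map_mul, map_smul, FreeAlgebra.lift_ι_apply] using ht.r5
    · simpa only [map_mul, map_sub, map_smul, FreeAlgebra.lift_ι_apply] using ht.r6
    · simpa only [map_mul, map_sub, map_smul, map_one, FreeAlgebra.lift_ι_apply] using ht.r7⟩

theorem polLift_tPol {q : ℝ} {A : Type*} [Ring A] [Algebra ℂ A] (t : TGen → A)
    (ht : IsQuantumSL2 q t) (g : TGen) : polLift t ht (tPol q g) = t g := by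
  simp [polLift, tPol]

theorem pol_induction {q : ℝ} {P : Pol q → Prop} (halg : ∀ c : ℂ, P (algebraMap ℂ _ c))
    (hgen : ∀ g, P (tPol q g)) (hmul : ∀ a b, P a → P b → P (a * b))
    (hadd : ∀ a b, P a → P b → P (a + b)) (a : Pol q) : P a := by
  obtain ⟨a, rfl⟩ := RingQuot.mkAlgHom_surjective ℂ (TRel q) a
  induction a using FreeAlgebra.induction with
  | grade0 c => rw [AlgHom.commutes]; exact halg c
  | grade1 g => exact hgen g
  | mul a b ha hb => rw [map_mul]; exact hmul _ _ ha hb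
  | add a b ha hb => rw [map_add]; exact hadd _ _ ha hb

/-- Upper triangular `2 × 2` matrices, used to construct twisted derivations. -/
theorem isQuantumSL2_triangular {q : ℝ} {A : Type*} [Ring A] [Algebra ℂ A] (a d b : TGen → A)
    (ha : IsQuantumSL2 q a) (hb : IsQuantumSL2 q b)
    (h1 : a .t11 * d .t12 + d .t11 * b .t12 = (q : ℂ) • (a .t12 * d .t11 + d .t12 * b .t11))
    (h2 : a .t21 * d .t22 + d .t21 * b .t22 = (q : ℂ) • (a .t22 * d .t21 + d .t22 * b .t21))
    (h3 : a .t11 * d .t21 + d .t11 * b .t21 = (q : ℂ) • (a .t21 * d .t11 + d .t21 * b .t11))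
    (h4 : a .t12 * d .t22 + d .t12 * b .t22 = (q : ℂ) • (a .t22 * d .t12 + d .t22 * b .t12))
    (h5 : a .t12 * d .t21 + d .t12 * b .t21 = a .t21 * d .t12 + d .t21 * b .t12)
    (h6 : a .t11 * d .t22 + d .t11 * b .t22 - (a .t22 * d .t11 + d .t22 * b .t11)
      = ((q : ℂ) - (q : ℂ)⁻¹) • (a .t12 * d .t21 + d .t12 * b .t21))
    (h7 : a .t11 * d .t22 + d .t11 * b .t22 - (q : ℂ) • (a .t12 * d .t21 + d .t12 * b .t21) = 0) :
    IsQuantumSL2 q (fun g => !![a g, d g; 0, b g]) where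
  r1 := by
    ext i j; fin_cases i <;> fin_cases j
    · simpa [Matrix.mul_apply, Fin.sum_univ_two] using ha.r1
    · simpa [Matrix.mul_apply, Fin.sum_univ_two] using h1
    · simp [Matrix.mul_apply, Fin.sum_univ_two]
    · simpa [Matrix.mul_apply, Fin.sum_univ_two] using hb.r1
  r2 := by
    ext i j; fin_cases i <;> fin_cases j
    · simpa [Matrix.mul_apply, Fin.sum_univ_two] using ha.r2
    · simpa [Matrix.mul_apply, Fin.sum_univ_two] using h2
    · simp [Matrix.mul_apply, Fin.sum_univ_two]
    · simpa [Matrix.mul_apply, Fin.sum_univ_two] using hb.r2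
  r3 := by
    ext i j; fin_cases i <;> fin_cases j
    · simpa [Matrix.mul_apply, Fin.sum_univ_two] using ha.r3
    · simpa [Matrix.mul_apply, Fin.sum_univ_two] using h3
    · simp [Matrix.mul_apply, Fin.sum_univ_two]
    · simpa [Matrix.mul_apply, Fin.sum_univ_two] using hb.r3
  r4 := by
    ext i j; fin_cases i <;> fin_cases j
    · simpa [Matrix.mul_apply, Fin.sum_univ_two] using ha.r4
    · simpa [Matrix.mul_apply, Fin.sum_univ_two] using h4
    · simp [Matrix.mul_apply, Fin.sum_univ_two]
    · simpa [Matrix.mul_apply, Fin.sum_univ_two] using hb.r4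
  r5 := by
    ext i j; fin_cases i <;> fin_cases j
    · simpa [Matrix.mul_apply, Fin.sum_univ_two] using ha.r5
    · simpa [Matrix.mul_apply, Fin.sum_univ_two] using h5
    · simp [Matrix.mul_apply, Fin.sum_univ_two]
    · simpa [Matrix.mul_apply, Fin.sum_univ_two] using hb.r5
  r6 := by
    ext i j; fin_cases i <;> fin_cases j
    · simpa [Matrix.mul_apply, Fin.sum_univ_two] using ha.r6
    · simpa [Matrix.mul_apply, Fin.sum_univ_two] using h6
    · simp
    · simpa [Matrix.mul_apply, Fin.sum_univ_two] using hb.r6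
  r7 := by
    ext i j; fin_cases i <;> fin_cases j
    · simpa [Matrix.mul_apply, Fin.sum_univ_two] using ha.r7
    · simpa [Matrix.mul_apply, Fin.sum_univ_two] using h7
    · simp
    · simpa [Matrix.mul_apply, Fin.sum_univ_two] using hb.r7

/-! ### The action of `U_q su(1,1)` on `Pol(X̃)_q` -/

/-- The weights: `H t_{i1} = t_{i1}`, `H t_{i2} = -t_{i2}`. -/
def wt : TGen → ℤ
  | .t11 => 1
  | .t12 => -1
  | .t21 => 1
  | .t22 => -1

/-- `X⁺ t_{i1} = 0`, `X⁺ t_{i2} = t_{i1}`. -/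
def XpGen (q : ℝ) : TGen → Pol q
  | .t11 => 0
  | .t12 => tPol q .t11
  | .t21 => 0
  | .t22 => tPol q .t21

/-- `X⁻ t_{i1} = t_{i2}`, `X⁻ t_{i2} = 0`. -/
def XmGen (q : ℝ) : TGen → Pol q
  | .t11 => tPol q .t12
  | .t12 => 0
  | .t21 => tPol q .t22
  | .t22 => 0

theorem isQuantumSL2_scale {q : ℝ} {A : Type*} [Ring A] [Algebra ℂ A] (t : TGen → A)
    (ht : IsQuantumSL2 q t) (c : ℂ) (hc : c ≠ 0) :
    IsQuantumSL2 q (fun g => c ^ wt g • t g) where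
  r1 := by simp [wt, smul_smul, hc, ht.r1]
  r2 := by simp [wt, smul_smul, hc, ht.r2]
  r3 := by simp only [wt, smul_mul_smul_comm, ht.r3, smul_smul, mul_comm]
  r4 := by simp only [wt, smul_mul_smul_comm, ht.r4, smul_smul, mul_comm]
  r5 := by simp [wt, smul_smul, hc, ht.r5]
  r6 := by simpa [wt, smul_smul, hc] using ht.r6
  r7 := by simpa [wt, smul_smul, hc] using ht.r7

/-- `q^{1/2}` as a complex number. -/
def qh (q : ℝ) : ℂ := (Real.sqrt q : ℂ)

theorem qh_ne_zero {q : ℝ} (hq : q ∈ Set.Ioo (0 : ℝ) 1) : qh q ≠ 0 := by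
  have := (Real.sqrt_pos.mpr hq.1).ne'
  simpa [qh] using this

theorem qh_mul_self {q : ℝ} (hq : q ∈ Set.Ioo (0 : ℝ) 1) : (q : ℂ) = qh q * qh q := by
  rw [qh, ← Complex.ofReal_mul, Real.mul_self_sqrt hq.1.le]

theorem isQuantumSL2_H (q : ℝ) :
    IsQuantumSL2 q (fun g => !![tPol q g, ((wt g : ℤ) : ℂ) • tPol q g; 0, tPol q g]) := by
  have h := isQuantumSL2_tPol q
  apply isQuantumSL2_triangular (tPol q) (fun g => ((wt g : ℤ) : ℂ) • tPol q g) (tPol q) h h <;>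
    simp only [wt, smul_mul_assoc, mul_smul_comm, h.r3, h.r4, Int.cast_one, Int.cast_neg, h.r5] <;>
    module

theorem isQuantumSL2_Xp {q : ℝ} (hq : q ∈ Set.Ioo (0 : ℝ) 1) :
    IsQuantumSL2 q (fun g => !![qh q ^ wt g • tPol q g, XpGen q g; 0,
      (qh q)⁻¹ ^ wt g • tPol q g]) := by
  have h := isQuantumSL2_tPol q
  have h0 := qh_ne_zero hq
  have hs := qh_mul_self hq
  have h6 := sub_eq_iff_eq_add.mp h.r6
  apply isQuantumSL2_triangular (fun g => qh q ^ wt g • tPol q g) (XpGen q)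
    (fun g => (qh q)⁻¹ ^ wt g • tPol q g) (isQuantumSL2_scale _ h _ h0)
    (isQuantumSL2_scale _ h _ (inv_ne_zero h0)) <;>
    simp only [wt, XpGen, smul_mul_assoc, mul_smul_comm, h6, h.r3, h.r5, hs, zpow_one, zpow_neg,
      mul_zero, zero_mul, smul_zero, add_zero, zero_add, inv_inv] <;>
    match_scalars <;> field_simp <;> ring

theorem isQuantumSL2_Xm {q : ℝ} (hq : q ∈ Set.Ioo (0 : ℝ) 1) :
    IsQuantumSL2 q (fun g => !![qh q ^ wt g • tPol q g, XmGen q g; 0,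
      (qh q)⁻¹ ^ wt g • tPol q g]) := by
  have h := isQuantumSL2_tPol q
  have h0 := qh_ne_zero hq
  have hs := qh_mul_self hq
  have h6 := sub_eq_iff_eq_add.mp h.r6
  apply isQuantumSL2_triangular (fun g => qh q ^ wt g • tPol q g) (XmGen q)
    (fun g => (qh q)⁻¹ ^ wt g • tPol q g) (isQuantumSL2_scale _ h _ h0)
    (isQuantumSL2_scale _ h _ (inv_ne_zero h0)) <;>
    simp only [wt, XmGen, smul_mul_assoc, mul_smul_comm, h6, h.r4, h.r5, hs, zpow_one, zpow_neg,
      mul_zero, zero_mul, smul_zero, add_zero, zero_add, inv_inv] <;>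
    match_scalars <;> field_simp <;> ring

/-- The action of `k = q^{H/2}` (for `c = q^{1/2}`) and of `k⁻¹` (for `c = q^{-1/2}`): the algebra
automorphism with `t_{ij} ↦ c^{wt(t_{ij})} t_{ij}`. -/
def scaleAlg (q : ℝ) (c : ℂ) (hc : c ≠ 0) : Pol q →ₐ[ℂ] Pol q :=
  polLift _ (isQuantumSL2_scale _ (isQuantumSL2_tPol q) c hc)

/-- The upper right corner of a homomorphism to `2 × 2` matrices. -/
def corner {q : ℝ} (T : Pol q →ₐ[ℂ] Matrix (Fin 2) (Fin 2) (Pol q)) : Module.End ℂ (Pol q) where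
  toFun f := T f 0 1
  map_add' f g := by simp
  map_smul' c f := by simp

theorem corner_apply {q : ℝ} (T : Pol q →ₐ[ℂ] Matrix (Fin 2) (Fin 2) (Pol q)) (f : Pol q) :
    corner T f = T f 0 1 := rfl

/-- The action of `k = e^{-hH/4}`. -/
def opK {q : ℝ} (hq : q ∈ Set.Ioo (0 : ℝ) 1) : Pol q →ₐ[ℂ] Pol q :=
  scaleAlg q (qh q) (qh_ne_zero hq)

/-- The action of `k⁻¹ = e^{hH/4}`. -/
def opKinv {q : ℝ} (hq : q ∈ Set.Ioo (0 : ℝ) 1) : Pol q →ₐ[ℂ] Pol q :=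
  scaleAlg q (qh q)⁻¹ (inv_ne_zero (qh_ne_zero hq))

/-- The action of `H`; see `opH_gen` and `opH_mul` for the properties that determine it. -/
def opH (q : ℝ) : Module.End ℂ (Pol q) := corner (polLift _ (isQuantumSL2_H q))

/-- The action of `X⁺`; see `opXp_gen` and `opXp_mul` for the properties that determine it. -/
def opXp {q : ℝ} (hq : q ∈ Set.Ioo (0 : ℝ) 1) : Module.End ℂ (Pol q) :=
  corner (polLift _ (isQuantumSL2_Xp hq))

/-- The action of `X⁻`; see `opXm_gen` and `opXm_mul` for the properties that determine it. -/
def opXm {q : ℝ} (hq : q ∈ Set.Ioo (0 : ℝ) 1) : Module.End ℂ (Pol q) :=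
  corner (polLift _ (isQuantumSL2_Xm hq))

theorem opK_gen {q : ℝ} (hq : q ∈ Set.Ioo (0 : ℝ) 1) (g : TGen) :
    opK hq (tPol q g) = qh q ^ wt g • tPol q g := by
  rw [opK, scaleAlg, polLift_tPol]

theorem opKinv_gen {q : ℝ} (hq : q ∈ Set.Ioo (0 : ℝ) 1) (g : TGen) :
    opKinv hq (tPol q g) = (qh q)⁻¹ ^ wt g • tPol q g := by
  rw [opKinv, scaleAlg, polLift_tPol]

theorem opH_gen (q : ℝ) (g : TGen) : opH q (tPol q g) = ((wt g : ℤ) : ℂ) • tPol q g := by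
  rw [opH, corner_apply, polLift_tPol]; rfl

theorem opXp_gen {q : ℝ} (hq : q ∈ Set.Ioo (0 : ℝ) 1) (g : TGen) :
    opXp hq (tPol q g) = XpGen q g := by
  rw [opXp, corner_apply, polLift_tPol]; rfl

theorem opXm_gen {q : ℝ} (hq : q ∈ Set.Ioo (0 : ℝ) 1) (g : TGen) :
    opXm hq (tPol q g) = XmGen q g := by
  rw [opXm, corner_apply, polLift_tPol]; rfl

theorem triangular_diag {q : ℝ} (a d b : TGen → Pol q)
    (h : IsQuantumSL2 q (fun g => !![a g, d g; 0, b g])) (α β : Pol q →ₐ[ℂ] Pol q)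
    (hα : ∀ g, α (tPol q g) = a g) (hβ : ∀ g, β (tPol q g) = b g) (f : Pol q) :
    polLift _ h f 0 0 = α f ∧ polLift _ h f 1 0 = 0 ∧ polLift _ h f 1 1 = β f := by
  induction f using pol_induction with
  | halg c => simp [AlgHom.commutes, Matrix.algebraMap_matrix_apply]
  | hgen g => simp [polLift_tPol, hα, hβ]
  | hmul x y hx hy =>
    simp only [map_mul, Matrix.mul_apply, Fin.sum_univ_two, hx, hy]
    simp
  | hadd x y hx hy =>
    simp only [map_add, Matrix.add_apply, hx, hy]
    simp

theorem corner_algebraMap {q : ℝ} (T : Pol q →ₐ[ℂ] Matrix (Fin 2) (Fin 2) (Pol q)) (c : ℂ) :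
    corner T (algebraMap ℂ _ c) = 0 := by
  rw [corner_apply, AlgHom.commutes]
  simp [Matrix.algebraMap_matrix_apply]

theorem corner_mul {q : ℝ} (T : Pol q →ₐ[ℂ] Matrix (Fin 2) (Fin 2) (Pol q)) (f g : Pol q) :
    corner T (f * g) = corner T f * T g 1 1 + T f 0 0 * corner T g := by
  rw [corner_apply, map_mul, Matrix.mul_apply, Fin.sum_univ_two, add_comm]; rfl

/-- `H(fg) = Hf · g + f · Hg`, as `Δ(H) = H ⊗ 1 + 1 ⊗ H`. -/
theorem opH_mul (q : ℝ) (f g : Pol q) : opH q (f * g) = opH q f * g + f * opH q g := by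
  have h := triangular_diag _ _ _ (isQuantumSL2_H q) (AlgHom.id ℂ _) (AlgHom.id ℂ _)
    (fun _ => rfl) (fun _ => rfl)
  rw [opH, corner_mul, (h f).1, (h g).2.2]; rfl

/-- `X⁺(fg) = X⁺f · k⁻¹g + kf · X⁺g`, as
`Δ(X⁺) = X⁺ ⊗ e^{hH/4} + e^{-hH/4} ⊗ X⁺`. -/
theorem opXp_mul {q : ℝ} (hq : q ∈ Set.Ioo (0 : ℝ) 1) (f g : Pol q) :
    opXp hq (f * g) = opXp hq f * opKinv hq g + opK hq f * opXp hq g := by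
  have h := triangular_diag _ _ _ (isQuantumSL2_Xp hq) (opK hq) (opKinv hq)
    (opK_gen hq) (opKinv_gen hq)
  rw [opXp, corner_mul, (h f).1, (h g).2.2]

/-- `X⁻(fg) = X⁻f · k⁻¹g + kf · X⁻g`, as
`Δ(X⁻) = X⁻ ⊗ e^{hH/4} + e^{-hH/4} ⊗ X⁻`. -/
theorem opXm_mul {q : ℝ} (hq : q ∈ Set.Ioo (0 : ℝ) 1) (f g : Pol q) :
    opXm hq (f * g) = opXm hq f * opKinv hq g + opK hq f * opXm hq g := by
  have h := triangular_diag _ _ _ (isQuantumSL2_Xm hq) (opK hq) (opKinv hq)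
    (opK_gen hq) (opKinv_gen hq)
  rw [opXm, corner_mul, (h f).1, (h g).2.2]

theorem opH_algebraMap (q : ℝ) (c : ℂ) : opH q (algebraMap ℂ _ c) = 0 := corner_algebraMap _ c

theorem opXp_algebraMap {q : ℝ} (hq : q ∈ Set.Ioo (0 : ℝ) 1) (c : ℂ) :
    opXp hq (algebraMap ℂ _ c) = 0 := corner_algebraMap _ c

theorem opXm_algebraMap {q : ℝ} (hq : q ∈ Set.Ioo (0 : ℝ) 1) (c : ℂ) :
    opXm hq (algebraMap ℂ _ c) = 0 := corner_algebraMap _ c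

theorem opK_opKinv {q : ℝ} (hq : q ∈ Set.Ioo (0 : ℝ) 1) (f : Pol q) :
    opK hq (opKinv hq f) = f := by
  induction f using pol_induction with
  | halg c => rw [AlgHom.commutes, AlgHom.commutes]
  | hgen g =>
    have h0 := zpow_ne_zero (wt g) (qh_ne_zero hq)
    simp only [opK_gen, opKinv_gen, map_smul, inv_zpow, smul_smul, inv_mul_cancel₀ h0, one_smul]
  | hmul x y hx hy => rw [map_mul, map_mul, hx, hy]
  | hadd x y hx hy => rw [map_add, map_add, hx, hy]

theorem opKinv_opK {q : ℝ} (hq : q ∈ Set.Ioo (0 : ℝ) 1) (f : Pol q) :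
    opKinv hq (opK hq f) = f := by
  induction f using pol_induction with
  | halg c => rw [AlgHom.commutes, AlgHom.commutes]
  | hgen g =>
    have h0 := zpow_ne_zero (wt g) (qh_ne_zero hq)
    simp only [opK_gen, opKinv_gen, map_smul, inv_zpow, smul_smul, mul_inv_cancel₀ h0, one_smul]
  | hmul x y hx hy => rw [map_mul, map_mul, hx, hy]
  | hadd x y hx hy => rw [map_add, map_add, hx, hy]

theorem opK_opH {q : ℝ} (hq : q ∈ Set.Ioo (0 : ℝ) 1) (f : Pol q) :
    opK hq (opH q f) = opH q (opK hq f) := by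
  induction f using pol_induction with
  | halg c => rw [AlgHom.commutes, opH_algebraMap, map_zero]
  | hgen g => simp only [opK_gen, opH_gen, map_smul, smul_smul, mul_comm]
  | hmul x y hx hy => simp only [map_mul, opH_mul, map_add, hx, hy]
  | hadd x y hx hy => simp only [map_add, hx, hy]

theorem opKinv_opH {q : ℝ} (hq : q ∈ Set.Ioo (0 : ℝ) 1) (f : Pol q) :
    opKinv hq (opH q f) = opH q (opKinv hq f) := by
  have h := opK_opH hq (opKinv hq f)
  rw [opK_opKinv] at h
  rw [← h, opKinv_opK]

theorem opK_opXp {q : ℝ} (hq : q ∈ Set.Ioo (0 : ℝ) 1) (f : Pol q) :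
    opK hq (opXp hq f) = (q : ℂ) • opXp hq (opK hq f) := by
  have h0 := qh_ne_zero hq
  induction f using pol_induction with
  | halg c => rw [AlgHom.commutes, opXp_algebraMap, map_zero, smul_zero]
  | hgen g =>
    rw [qh_mul_self hq]
    cases g <;> simp only [opXp_gen, opK_gen, XpGen, wt, map_zero, map_smul, smul_zero] <;>
      match_scalars <;> simp [h0]
  | hmul x y hx hy =>
    simp only [map_mul, opXp_mul, map_add, hx, hy, opK_opKinv, opKinv_opK, smul_add,
      smul_mul_assoc, mul_smul_comm]
  | hadd x y hx hy => simp only [map_add, hx, hy, smul_add]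

theorem opK_opXm {q : ℝ} (hq : q ∈ Set.Ioo (0 : ℝ) 1) (f : Pol q) :
    opK hq (opXm hq f) = (q : ℂ)⁻¹ • opXm hq (opK hq f) := by
  have h0 := qh_ne_zero hq
  induction f using pol_induction with
  | halg c => rw [AlgHom.commutes, opXm_algebraMap, map_zero, smul_zero]
  | hgen g =>
    rw [qh_mul_self hq]
    cases g <;> simp only [opXm_gen, opK_gen, XmGen, wt, map_zero, map_smul, smul_zero] <;>
      match_scalars <;> simp [h0]
  | hmul x y hx hy =>
    simp only [map_mul, opXm_mul, map_add, hx, hy, opK_opKinv, opKinv_opK, smul_add,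
      smul_mul_assoc, mul_smul_comm]
  | hadd x y hx hy => simp only [map_add, hx, hy, smul_add]

theorem opKinv_opXp {q : ℝ} (hq : q ∈ Set.Ioo (0 : ℝ) 1) (f : Pol q) :
    opKinv hq (opXp hq f) = (q : ℂ)⁻¹ • opXp hq (opKinv hq f) := by
  have hq0 : (q : ℂ) ≠ 0 := by exact_mod_cast hq.1.ne'
  have h := congrArg (opKinv hq) (opK_opXp hq (opKinv hq f))
  rw [opKinv_opK, opK_opKinv, map_smul] at h
  rw [h, smul_smul, inv_mul_cancel₀ hq0, one_smul]

theorem opKinv_opXm {q : ℝ} (hq : q ∈ Set.Ioo (0 : ℝ) 1) (f : Pol q) :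
    opKinv hq (opXm hq f) = (q : ℂ) • opXm hq (opKinv hq f) := by
  have hq0 : (q : ℂ) ≠ 0 := by exact_mod_cast hq.1.ne'
  have h := congrArg (opKinv hq) (opK_opXm hq (opKinv hq f))
  rw [opKinv_opK, opK_opKinv, map_smul] at h
  rw [h, smul_smul, mul_inv_cancel₀ hq0, one_smul]

theorem opH_opXp {q : ℝ} (hq : q ∈ Set.Ioo (0 : ℝ) 1) (f : Pol q) :
    opH q (opXp hq f) = opXp hq (opH q f) + (2 : ℂ) • opXp hq f := by
  induction f using pol_induction with
  | halg c => simp only [opH_algebraMap, opXp_algebraMap, map_zero, smul_zero, add_zero]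
  | hgen g =>
    cases g <;> simp only [opXp_gen, opH_gen, XpGen, wt, map_zero, map_smul, smul_zero] <;>
      match_scalars <;> norm_num
  | hmul x y hx hy =>
    simp only [opH_mul, opXp_mul, map_add, hx, hy, opK_opH, opKinv_opH, add_mul, mul_add,
      smul_mul_assoc, mul_smul_comm]
    module
  | hadd x y hx hy => simp only [map_add, hx, hy]; module

theorem opH_opXm {q : ℝ} (hq : q ∈ Set.Ioo (0 : ℝ) 1) (f : Pol q) :
    opH q (opXm hq f) = opXm hq (opH q f) + (-2 : ℂ) • opXm hq f := by
  induction f using pol_induction with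
  | halg c => simp only [opH_algebraMap, opXm_algebraMap, map_zero, smul_zero, add_zero]
  | hgen g =>
    cases g <;> simp only [opXm_gen, opH_gen, XmGen, wt, map_zero, map_smul, smul_zero] <;>
      match_scalars <;> norm_num
  | hmul x y hx hy =>
    simp only [opH_mul, opXm_mul, map_add, hx, hy, opK_opH, opKinv_opH, add_mul, mul_add,
      smul_mul_assoc, mul_smul_comm]
    module
  | hadd x y hx hy => simp only [map_add, hx, hy]; module

theorem opXp_opXm {q : ℝ} (hq : q ∈ Set.Ioo (0 : ℝ) 1) (f : Pol q) :
    opXp hq (opXm hq f) = opXm hq (opXp hq f) +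
      ((q : ℂ) - (q : ℂ)⁻¹)⁻¹ • (opK hq (opK hq f) - opKinv hq (opKinv hq f)) := by
  have h0 := qh_ne_zero hq
  have hq0 : (q : ℂ) ≠ 0 := by exact_mod_cast hq.1.ne'
  have hne : (q : ℂ) - (q : ℂ)⁻¹ ≠ 0 := by
    have h1 : q - q⁻¹ < 0 := by
      have := (one_lt_inv₀ hq.1).mpr hq.2
      linarith [hq.2]
    exact_mod_cast h1.ne
  induction f using pol_induction with
  | halg c =>
    simp only [AlgHom.commutes, opXp_algebraMap, opXm_algebraMap, map_zero, sub_self, smul_zero,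
      add_zero]
  | hgen g =>
    cases g <;> simp only [opXm_gen, opXp_gen, opK_gen, opKinv_gen, XmGen, XpGen, wt, map_zero,
      map_smul, zpow_one, zpow_neg, smul_smul, ← sub_smul, inv_inv, ← mul_inv,
      ← qh_mul_self hq, inv_mul_cancel₀ hne]
    · simp
    · rw [← neg_sub (q : ℂ), mul_neg, inv_mul_cancel₀ hne]; simp
    · simp
    · rw [← neg_sub (q : ℂ), mul_neg, inv_mul_cancel₀ hne]; simp
  | hmul x y hx hy =>
    simp only [opXp_mul, opXm_mul, map_add, map_mul, hx, hy, opK_opXp, opK_opXm, opKinv_opXp,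
      opKinv_opXm, add_mul, mul_add, smul_mul_assoc, mul_smul_comm, mul_sub, sub_mul]
    module
  | hadd x y hx hy => simp only [map_add, hx, hy]; module

/-- The values on generators of the representation of `U_q su(1,1)` in `Pol(X̃)_q`. -/
def polActionGen {q : ℝ} (hq : q ∈ Set.Ioo (0 : ℝ) 1) : UGen → Module.End ℂ (Pol q)
  | .H => opH q
  | .Xp => opXp hq
  | .Xm => opXm hq
  | .k => (opK hq).toLinearMap
  | .kinv => (opKinv hq).toLinearMap

/-- The representation of `U_q su(1,1)` in `Pol(X̃)_q`. -/
def polAction {q : ℝ} (hq : q ∈ Set.Ioo (0 : ℝ) 1) : Uq q →ₐ[ℂ] Module.End ℂ (Pol q) :=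
  RingQuot.liftAlgHom ℂ ⟨FreeAlgebra.lift ℂ (polActionGen hq), by
    intro x y h
    cases h <;> simp only [map_mul, map_sub, map_smul, map_pow, map_one,
      FreeAlgebra.lift_ι_apply, polActionGen] <;> refine LinearMap.ext fun f => ?_
    · exact opK_opKinv hq f
    · exact opKinv_opK hq f
    · exact opK_opH hq f
    · exact opK_opXp hq f
    · exact opK_opXm hq f
    · exact sub_eq_of_eq_add' (opH_opXp hq f)
    · exact sub_eq_of_eq_add' (opH_opXm hq f)
    · rw [sq, sq]; exact sub_eq_of_eq_add' (opXp_opXm hq f)⟩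

/-! ### Distributions, finite functions and the integral -/

/-- The index set `M''` of quadruples `(i₁, i₂, j₁, j₂)` with `i₁ j₁ = i₂ j₂ = 0`. -/
structure Idx where
  i₁ : ℕ
  i₂ : ℕ
  j₁ : ℕ
  j₂ : ℕ
  h₁ : i₁ * j₁ = 0
  h₂ : i₂ * j₂ = 0

/-- The element `t₁₁* = -t₂₂`. -/
def t11star (q : ℝ) : Pol q := -tPol q .t22

/-- The element `t₁₂* = -q t₂₁`. -/
def t12star (q : ℝ) : Pol q := -((q : ℂ) • tPol q .t21)

/-- The element `x = t₁₂ t₁₂*`. -/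
def xPol (q : ℝ) : Pol q := tPol q .t12 * t12star q

/-- The element `∑ t₁₁^{i₁} t₁₂^{i₂} ψ_{i₁i₂j₁j₂}(x) t₁₂*^{j₂} t₁₁*^{j₁}` of `Pol(X̃)_q`, for a
finitely supported family of polynomials `ψ` indexed by `M''`. -/
def expand (q : ℝ) (ψ : Idx →₀ Polynomial ℂ) : Pol q :=
  ψ.sum fun i p => tPol q .t11 ^ i.i₁ * tPol q .t12 ^ i.i₂ * Polynomial.aeval (xPol q) p *
    t12star q ^ i.j₂ * t11star q ^ i.j₁

/-- The space of distributions `D(X̃)_q'`: formal series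
`∑ t₁₁^{i₁} t₁₂^{i₂} ψ_{i₁i₂j₁j₂}(x) t₁₂*^{j₂} t₁₁*^{j₁}` whose coefficients are functions on
`q^{-2ℤ₊}`, with the topology of pointwise convergence of the coefficients. Such a series is stored
as the family of numbers `f i m = ψ_i(q^{-2m})`. -/
abbrev Distr : Type := Idx → ℕ → ℂ

/-- The formal series with polynomial coefficients `ψ`; this is the element `expand q ψ` of
`Pol(X̃)_q`, regarded as a distribution. -/
def toDistr (q : ℝ) (ψ : Idx →₀ Polynomial ℂ) : Distr :=
  fun i m => (ψ i).eval (((q : ℂ) ^ (2 * m))⁻¹)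

/-- A representation of `U_q su(1,1)` by continuous operators in `D(X̃)_q'` extends by continuity
the one in `Pol(X̃)_q` if it agrees with it on the image of `Pol(X̃)_q`. -/
def ExtendsPolAction {q : ℝ} (hq : q ∈ Set.Ioo (0 : ℝ) 1) (ρ : Uq q →ₐ[ℂ] (Distr →L[ℂ] Distr)) :
    Prop :=
  ∀ (ξ : Uq q) (ψ φ : Idx →₀ Polynomial ℂ),
    polAction hq ξ (expand q ψ) = expand q φ → ρ ξ (toDistr q ψ) = toDistr q φ

/-- The space `D(X̃)_q` of finite functions: only finitely many numbers `ψ_i(q^{-2m})` are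
nonzero. -/
def FinFun : Submodule ℂ Distr where
  carrier := {f | {p : Idx × ℕ | f p.1 p.2 ≠ 0}.Finite}
  zero_mem' := by simp
  add_mem' := by
    intro f g hf hg
    refine (hf.union hg).subset fun p hp => ?_
    by_contra h
    simp only [Set.mem_union, Set.mem_ofPred_eq, not_or, not_not] at h
    exact hp (by simp [h.1, h.2])
  smul_mem' := by
    intro c f hf
    refine hf.subset fun p hp h => hp ?_
    simp [h]

/-- The index `(0,0,0,0)`. -/
def idx0 : Idx := ⟨0, 0, 0, 0, rfl, rfl⟩

theorem summable_coeff (q : ℝ) (f : FinFun) :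
    Summable fun m : ℕ => (f : Distr) idx0 m * ((q : ℂ) ^ (2 * m))⁻¹ := by
  refine summable_of_hasFiniteSupport ?_
  refine (f.2.preimage (f := fun m : ℕ => (idx0, m)) (fun a _ b _ h => by simpa using h)).subset ?_
  intro m hm h
  exact hm (by simp [h])

/-- The linear functional `f ↦ (1 - q²) ∑_{m ≥ 0} ψ_{0000}(q^{-2m}) q^{-2m}` on `D(X̃)_q` (the sum
has finitely many nonzero terms). -/
def nu (q : ℝ) : FinFun →ₗ[ℂ] ℂ where
  toFun f := (1 - (q : ℂ) ^ 2) * ∑' m : ℕ, (f : Distr) idx0 m * ((q : ℂ) ^ (2 * m))⁻¹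
  map_add' f g := by
    rw [← mul_add, ← (summable_coeff q f).tsum_add (summable_coeff q g)]
    simp [add_mul]
  map_smul' c f := by
    simp only [Submodule.coe_smul, Pi.smul_apply, smul_eq_mul, mul_assoc, tsum_mul_left,
      RingHom.id_apply]
    ring

end QuantumSU11

end

noncomputable section

namespace QuantumSU11

/-! ### The matrix model of distributions -/

/-! Distributions are modelled by infinite matrices whose entries are series in a phase `z`. On row
`r`, `t₁₂` acts as `q^{-r} z`, `t₁₂*` as `q^{-r} z⁻¹`, and `t₁₁` is a weighted shift with weights
`s(r)`, `s(r)² = q^{-2r} - 1`; `t₁₁*` is its transpose. Hence `x` acts as `q^{-2r}`, and each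
ordered monomial with coefficient `ψ_i(x)` fills one diagonal in one power of `z`. The value
`ψ_i(q^{-2m})` is a single matrix entry up to a nonzero scalar, so distributions and matrices are
homeomorphic (`toMat`, `ofMat`), and a polynomial `f` goes to the matrix `f · 1`
(`polDistr_expand`).

On matrices `H` and `k^{±1}` are diagonal, and `X^±` are twisted commutators with the weighted
shifts times `z^{∓1}`. They satisfy the same Leibniz rules as on polynomials and act on the unit
matrix through the counit, so `f ↦ f · 1` intertwines the two actions (`uMat_polMat`). The defining
relations are never checked on matrices: they hold on polynomials, which are dense by interpolation
at the nodes `q^{-2m}`, and pass to the limit by continuity. Density also gives uniqueness, once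
every polynomial is known to have an ordered expansion (`expand_surjective`).

The integral is the weighted trace `(1 - q²) ∑ F(m,m) q^{-2m}` of the phase-free diagonal. With this
weight, `uF - ε(u)F` contributes a telescoping sum for each generator `u` (`diag_uMat_eq_sub`), with
no boundary terms: `s(0) = 0` at one end, finite support at the other. -/

/-- Matrices over `ℕ × ℕ` whose entries are formal Laurent series in a phase: `F r c b` is the
coefficient of the `b`-th power of the phase in the entry `(r, c)`. -/
abbrev Mat : Type := ℕ → ℕ → ℤ → ℂ

/-- The matrix element `(q^{-2r} - 1)^{1/2}` of `t₁₁`. -/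
def shiftCoeff (q : ℝ) (r : ℕ) : ℂ := (Real.sqrt ((q ^ (2 * r))⁻¹ - 1) : ℂ)

theorem shiftCoeff_zero (q : ℝ) : shiftCoeff q 0 = 0 := by simp [shiftCoeff]

theorem shiftCoeff_arg_nonneg {q : ℝ} (hq : q ∈ Set.Ioo (0 : ℝ) 1) (r : ℕ) :
    0 ≤ (q ^ (2 * r))⁻¹ - 1 :=
  sub_nonneg.mpr <| (one_le_inv₀ (pow_pos hq.1 _)).mpr (pow_le_one₀ hq.1.le hq.2.le)

theorem shiftCoeff_mul_self {q : ℝ} (hq : q ∈ Set.Ioo (0 : ℝ) 1) (r : ℕ) :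
    shiftCoeff q r * shiftCoeff q r = ((q : ℂ) ^ (2 * r))⁻¹ - 1 := by
  rw [shiftCoeff, ← Complex.ofReal_mul, Real.mul_self_sqrt (shiftCoeff_arg_nonneg hq r)]
  push_cast; rfl

theorem shiftCoeff_succ_ne_zero {q : ℝ} (hq : q ∈ Set.Ioo (0 : ℝ) 1) (r : ℕ) :
    shiftCoeff q (r + 1) ≠ 0 := by
  have h : 0 < (q ^ (2 * (r + 1)))⁻¹ - 1 :=
    sub_pos.mpr <| (one_lt_inv₀ (pow_pos hq.1 _)).mpr (pow_lt_one₀ hq.1.le hq.2 (by omega))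
  simpa [shiftCoeff] using (Real.sqrt_pos.mpr h).ne'

/-- Left multiplication of matrices by the generators of `Pol(X̃)_q`. -/
def tMat (q : ℝ) (t : TGen) : Module.End ℂ Mat where
  toFun F r c b := match t with
    -- At `r = 0` the truncated `r - 1` points back to row `0`, which is harmless because
    -- `shiftCoeff q 0 = 0`.
    | .t11 => shiftCoeff q r * F (r - 1) c b
    | .t12 => ((q : ℂ) ^ r)⁻¹ * F r c (b - 1)
    | .t21 => -(((q : ℂ) ^ (r + 1))⁻¹ * F r c (b + 1))
    | .t22 => -(shiftCoeff q (r + 1) * F (r + 1) c b)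
  map_add' F G := by funext r c b; cases t <;> simp <;> ring
  map_smul' a F := by funext r c b; cases t <;> simp <;> ring

theorem isQuantumSL2_tMat {q : ℝ} (hq : q ∈ Set.Ioo (0 : ℝ) 1) : IsQuantumSL2 q (tMat q) := by
  have hq0 : (q : ℂ) ≠ 0 := by exact_mod_cast hq.1.ne'
  have hg := shiftCoeff_mul_self hq
  constructor <;> refine LinearMap.ext fun F => ?_ <;> funext r c b <;>
    rcases r with _ | r <;>
    simp [tMat, shiftCoeff_zero, ← mul_assoc, hg] <;> field_simp <;> try ring_nf
  all_goals exact Or.inl trivial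

/-- The action of `Pol(X̃)_q` on matrices. -/
def matRep {q : ℝ} (hq : q ∈ Set.Ioo (0 : ℝ) 1) : Pol q →ₐ[ℂ] Module.End ℂ Mat :=
  polLift (tMat q) (isQuantumSL2_tMat hq)

theorem matRep_tPol {q : ℝ} (hq : q ∈ Set.Ioo (0 : ℝ) 1) (t : TGen) :
    matRep hq (tPol q t) = tMat q t := polLift_tPol _ _ t

/-! ### The quantum algebra acting on matrices -/

/-- The factor `(q^{-2} - 1)^{-1}`. -/
def kap (q : ℝ) : ℂ := (((q : ℂ) ^ 2)⁻¹ - 1)⁻¹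

/-- The matrix elements of the result of applying a generator of `U_q su(1,1)` to a matrix. -/
def uMatFun (q : ℝ) (u : UGen) (F : Mat) (r c : ℕ) (b : ℤ) : ℂ :=
  match u with
  | .H => ((r : ℂ) - c - b) * F r c b
  -- If `A` is the shift matrix with `A(r, r-1) = s(r)`, the bracket is a twisted commutator of the
  -- form `FA - AF`, times `z⁻¹`; `.Xm` uses the transpose of `A` and `z`.
  | .Xp => kap q * qh q ^ (r + c + b - 1) *
      ((q : ℂ) ^ (-b - 1) * shiftCoeff q (c + 1) * F r (c + 1) (b + 1) -
        shiftCoeff q r * F (r - 1) c (b + 1))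
  | .Xm => kap q * q * qh q ^ (r + c - b - 1) *
      ((q : ℂ) ^ (b - 1) * shiftCoeff q (r + 1) * F (r + 1) c (b - 1) -
        shiftCoeff q c * F r (c - 1) (b - 1))
  | .k => qh q ^ ((r : ℤ) - c - b) * F r c b
  | .kinv => (qh q)⁻¹ ^ ((r : ℤ) - c - b) * F r c b

/-- The operators on matrices that correspond to the generators of `U_q su(1,1)`. -/
def uMat (q : ℝ) (u : UGen) : Mat →L[ℂ] Mat where
  toFun := uMatFun q u
  map_add' F G := by funext r c b; cases u <;> simp [uMatFun] <;> ring
  map_smul' a F := by funext r c b; cases u <;> simp [uMatFun] <;> ring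
  cont := by
    refine continuous_pi fun r => continuous_pi fun c => continuous_pi fun b => ?_
    cases u <;> simp only [uMatFun] <;> fun_prop

theorem uMat_apply (q : ℝ) (u : UGen) (F : Mat) (r c : ℕ) (b : ℤ) :
    uMat q u F r c b = uMatFun q u F r c b := rfl

theorem uMat_k_tMat {q : ℝ} (hq : q ∈ Set.Ioo (0 : ℝ) 1) (t : TGen) (F : Mat) :
    uMat q .k (tMat q t F) = qh q ^ wt t • tMat q t (uMat q .k F) := by
  have h0 := qh_ne_zero hq
  funext r c b
  cases t <;> rcases r with _ | r <;>
    simp [uMat_apply, uMatFun, tMat, wt, shiftCoeff_zero, zpow_add₀ h0, zpow_sub₀ h0] <;>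
    field_simp <;> ring

theorem uMat_kinv_tMat {q : ℝ} (hq : q ∈ Set.Ioo (0 : ℝ) 1) (t : TGen) (F : Mat) :
    uMat q .kinv (tMat q t F) = (qh q)⁻¹ ^ wt t • tMat q t (uMat q .kinv F) := by
  have h0 := qh_ne_zero hq
  funext r c b
  cases t <;> rcases r with _ | r <;>
    simp [uMat_apply, uMatFun, tMat, wt, shiftCoeff_zero, zpow_add₀ h0, zpow_sub₀ h0] <;>
    field_simp <;> ring

theorem uMat_H_tMat (q : ℝ) (t : TGen) (F : Mat) :
    uMat q .H (tMat q t F) = (wt t : ℂ) • tMat q t F + tMat q t (uMat q .H F) := by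
  funext r c b
  cases t <;> rcases r with _ | r <;>
    simp [uMat_apply, uMatFun, tMat, wt, shiftCoeff_zero] <;> ring

theorem kap_mul {q : ℝ} (hq : q ∈ Set.Ioo (0 : ℝ) 1) : kap q * (1 - (q : ℂ) ^ 2) = (q : ℂ) ^ 2 := by
  have hq0 : (q : ℂ) ≠ 0 := by exact_mod_cast hq.1.ne'
  have h1 : 1 - (q : ℂ) ^ 2 ≠ 0 := by
    have : 1 - q ^ 2 ≠ 0 := by nlinarith [hq.1, hq.2]
    exact_mod_cast this
  rw [kap]
  have : ((q : ℂ) ^ 2)⁻¹ - 1 = (1 - (q : ℂ) ^ 2) / (q : ℂ) ^ 2 := by field_simp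
  rw [this]; field_simp

/-- Since `s(r+1)² - s(r)² = q^{-2r}(q^{-2} - 1)`, this fixes the normalization `kap` of the
commutators; it is what makes `X⁺ t₂₂ = t₂₁` and `X⁻ t₁₁ = t₁₂` come out right. -/
theorem kap_mul_shiftCoeff {q : ℝ} (hq : q ∈ Set.Ioo (0 : ℝ) 1) (r : ℕ) :
    kap q * (shiftCoeff q (r + 1) * shiftCoeff q (r + 1) - shiftCoeff q r * shiftCoeff q r) *
      (qh q * qh q) ^ (2 * r) = 1 := by
  have hq0 : (q : ℂ) ≠ 0 := by exact_mod_cast hq.1.ne'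
  rw [shiftCoeff_mul_self hq, shiftCoeff_mul_self hq, ← qh_mul_self hq]
  have h := kap_mul hq
  have h2 : (q : ℂ) ^ (2 * (r + 1)) = (q : ℂ) ^ (2 * r) * (q : ℂ) ^ 2 := by ring
  rw [h2]
  field_simp
  linear_combination h

theorem uMat_Xp_tMat {q : ℝ} (hq : q ∈ Set.Ioo (0 : ℝ) 1) (t : TGen) (F : Mat) :
    uMat q .Xp (tMat q t F) = matRep hq (XpGen q t) (uMat q .kinv F) +
      qh q ^ wt t • tMat q t (uMat q .Xp F) := by
  have h0 := qh_ne_zero hq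
  have hk := kap_mul hq
  have hg := kap_mul_shiftCoeff hq
  have hg0 : kap q * shiftCoeff q 1 ^ 2 = 1 := by
    simpa [shiftCoeff_zero, sq] using hg 0
  rw [qh_mul_self hq] at hk
  funext r c b
  cases t <;> rcases r with _ | r <;>
    simp [uMat_apply, uMatFun, XpGen, tMat, wt, matRep_tPol, shiftCoeff_zero, zpow_add₀ h0,
      zpow_sub₀ h0, qh_mul_self hq, mul_zpow] <;>
    field_simp
  · linear_combination qh q ^ (r * 4) * qh q * (qh q ^ b) ^ 2 * shiftCoeff q (r + 1) * F r c b * hk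
  · ring
  · linear_combination -((qh q ^ b) ^ 2 * qh q ^ 2 * F 0 c (b + 1)) * hg0
  · linear_combination -(qh q ^ 4 * (qh q ^ b) ^ 2 * F (r + 1) c (b + 1)) * hg (r + 1)

theorem uMat_Xm_tMat {q : ℝ} (hq : q ∈ Set.Ioo (0 : ℝ) 1) (t : TGen) (F : Mat) :
    uMat q .Xm (tMat q t F) = matRep hq (XmGen q t) (uMat q .kinv F) +
      qh q ^ wt t • tMat q t (uMat q .Xm F) := by
  have h0 := qh_ne_zero hq
  have hk := kap_mul hq
  have hg := kap_mul_shiftCoeff hq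
  have hg0 : kap q * shiftCoeff q 1 ^ 2 = 1 := by
    simpa [shiftCoeff_zero, sq] using hg 0
  rw [qh_mul_self hq] at hk
  funext r c b
  cases t <;> rcases r with _ | r <;>
    simp [uMat_apply, uMatFun, XmGen, tMat, wt, matRep_tPol, shiftCoeff_zero, zpow_add₀ h0,
      zpow_sub₀ h0, qh_mul_self hq, mul_zpow] <;>
    field_simp
  · linear_combination F 0 c (b - 1) * hg0
  · linear_combination (qh q ^ b) ^ 2 * F (r + 1) c (b - 1) * hg (r + 1)
  · ring
  · linear_combination -((qh q ^ b) ^ 2 * shiftCoeff q 1 * F 1 c b) * hk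
  · linear_combination -(qh q ^ 6 * qh q ^ (r * 4) * (qh q ^ b) ^ 2 *
      shiftCoeff q (r + 1 + 1) * F (r + 1 + 1) c b) * hk
  · ring
  · ring

/-! ### Leibniz rules and equivariance of `f ↦ f · 1` -/

section Leibniz

variable {q : ℝ} (hq : q ∈ Set.Ioo (0 : ℝ) 1)

/-- Here and in the next four lemmas a rule known for generators propagates to products. The matrix
`F` stays arbitrary in the induction because for `x * y` the rule for `x` is applied to the matrix
`y · F`. -/
theorem uMat_k_matRep (f : Pol q) (F : Mat) :
    uMat q .k (matRep hq f F) = matRep hq (opK hq f) (uMat q .k F) := by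
  induction f using pol_induction generalizing F with
  | halg c => simp [AlgHom.commutes, Module.algebraMap_end_apply]
  | hgen g => rw [opK_gen, map_smul, matRep_tPol, uMat_k_tMat hq]; rfl
  | hmul x y hx hy => simp only [map_mul, Module.End.mul_apply, hx, hy]
  | hadd x y hx hy => simp only [map_add, LinearMap.add_apply, hx, hy]

theorem uMat_kinv_matRep (f : Pol q) (F : Mat) :
    uMat q .kinv (matRep hq f F) = matRep hq (opKinv hq f) (uMat q .kinv F) := by
  induction f using pol_induction generalizing F with
  | halg c => simp [AlgHom.commutes, Module.algebraMap_end_apply]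
  | hgen g => rw [opKinv_gen, map_smul, matRep_tPol, uMat_kinv_tMat hq]; rfl
  | hmul x y hx hy => simp only [map_mul, Module.End.mul_apply, hx, hy]
  | hadd x y hx hy => simp only [map_add, LinearMap.add_apply, hx, hy]

theorem uMat_H_matRep (f : Pol q) (F : Mat) :
    uMat q .H (matRep hq f F) = matRep hq (opH q f) F + matRep hq f (uMat q .H F) := by
  induction f using pol_induction generalizing F with
  | halg c => simp [AlgHom.commutes, Module.algebraMap_end_apply, opH_algebraMap]
  | hgen g => rw [opH_gen, map_smul, matRep_tPol, uMat_H_tMat]; rfl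
  | hmul x y hx hy =>
    simp only [map_mul, Module.End.mul_apply, hx, hy, opH_mul, map_add, LinearMap.add_apply,
      add_assoc]
  | hadd x y hx hy => simp only [map_add, LinearMap.add_apply, hx, hy]; abel

theorem uMat_Xp_matRep (f : Pol q) (F : Mat) :
    uMat q .Xp (matRep hq f F) =
      matRep hq (opXp hq f) (uMat q .kinv F) + matRep hq (opK hq f) (uMat q .Xp F) := by
  induction f using pol_induction generalizing F with
  | halg c => simp [AlgHom.commutes, Module.algebraMap_end_apply, opXp_algebraMap]
  | hgen g => rw [opXp_gen, opK_gen, map_smul, matRep_tPol, uMat_Xp_tMat hq]; rfl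
  | hmul x y hx hy =>
    simp only [map_mul, Module.End.mul_apply, hx, hy, opXp_mul, map_add, LinearMap.add_apply,
      uMat_kinv_matRep, add_assoc]
  | hadd x y hx hy => simp only [map_add, LinearMap.add_apply, hx, hy]; abel

theorem uMat_Xm_matRep (f : Pol q) (F : Mat) :
    uMat q .Xm (matRep hq f F) =
      matRep hq (opXm hq f) (uMat q .kinv F) + matRep hq (opK hq f) (uMat q .Xm F) := by
  induction f using pol_induction generalizing F with
  | halg c => simp [AlgHom.commutes, Module.algebraMap_end_apply, opXm_algebraMap]
  | hgen g => rw [opXm_gen, opK_gen, map_smul, matRep_tPol, uMat_Xm_tMat hq]; rfl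
  | hmul x y hx hy =>
    simp only [map_mul, Module.End.mul_apply, hx, hy, opXm_mul, map_add, LinearMap.add_apply,
      uMat_kinv_matRep, add_assoc]
  | hadd x y hx hy => simp only [map_add, LinearMap.add_apply, hx, hy]; abel

/-- The identity matrix. -/
def oneMat : Mat := fun r c b => if r = c ∧ b = 0 then 1 else 0

/-- For `X⁺` both terms live only at `r = c + 1`, `b = -1`, where the twist `q^{-b-1}` is `1` and
the two shift weights cancel. `X⁻` is symmetric, at `c = r + 1`, `b = 1`. -/
theorem uMat_oneMat (q : ℝ) (u : UGen) : uMat q u oneMat = counitGen u • oneMat := by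
  funext r c b
  cases u <;> simp only [uMat_apply, uMatFun, oneMat, counitGen, Pi.smul_apply, smul_eq_mul]
  · rcases eq_or_ne r c with rfl | h
    · rcases eq_or_ne b 0 with rfl | h <;> simp [*]
    · simp [h]
  · rcases r with _ | r
    · simp [shiftCoeff_zero]
    · rcases eq_or_ne r c with rfl | h
      · rcases eq_or_ne b (-1) with rfl | h
        · simp
        · simp [add_eq_zero_iff_eq_neg, h]
      · simp [h]
  · rcases c with _ | c
    · simp [shiftCoeff_zero]
    · rcases eq_or_ne r c with rfl | h
      · rcases eq_or_ne b 1 with rfl | h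
        · simp
        · simp [sub_eq_zero, h]
      · simp [h]
  all_goals
    rcases eq_or_ne r c with rfl | h
    · rcases eq_or_ne b 0 with rfl | h <;> simp [*]
    · simp [h]

/-- The matrix of a polynomial. -/
def polMat : Pol q →ₗ[ℂ] Mat := LinearMap.applyₗ oneMat ∘ₗ (matRep hq).toLinearMap

theorem polMat_apply (f : Pol q) : polMat hq f = matRep hq f oneMat := rfl

/-- Take `F = 1` in the Leibniz rules: `k⁻¹` fixes the unit and `X^±`, `H` kill it, so only the term
with the generator applied to `f` survives. -/
theorem uMat_polMat (u : UGen) (f : Pol q) :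
    uMat q u (polMat hq f) = polMat hq (polActionGen hq u f) := by
  simp only [polMat_apply]
  cases u <;> simp only [uMat_H_matRep, uMat_k_matRep, uMat_kinv_matRep, uMat_Xp_matRep,
    uMat_Xm_matRep, uMat_oneMat, counitGen, polActionGen] <;> simp

end Leibniz

/-! ### Coefficients of a distribution as matrix entries -/

section Expansion

variable {q : ℝ} (hq : q ∈ Set.Ioo (0 : ℝ) 1)

/-- The formula is right even for `n > r`: the row index then truncates, but the product contains
the factor `s(r - r) = 0`. -/
theorem tMat_t11_pow (n : ℕ) (F : Mat) (r c : ℕ) (b : ℤ) :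
    (tMat q .t11 ^ n) F r c b = (∏ j ∈ Finset.range n, shiftCoeff q (r - j)) * F (r - n) c b := by
  induction n generalizing F with
  | zero => simp
  | succ n ih =>
    rw [pow_succ, Module.End.mul_apply, ih, Finset.prod_range_succ, mul_assoc]
    simp [tMat, Nat.sub_sub]

theorem tMat_t12_pow (n : ℕ) (F : Mat) (r c : ℕ) (b : ℤ) :
    (tMat q .t12 ^ n) F r c b = ((q : ℂ) ^ r)⁻¹ ^ n * F r c (b - n) := by
  induction n generalizing F with
  | zero => simp
  | succ n ih =>
    rw [pow_succ, Module.End.mul_apply, ih, pow_succ, mul_assoc]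
    simp [tMat, sub_sub]

theorem matRep_t12star (F : Mat) (r c : ℕ) (b : ℤ) :
    matRep hq (t12star q) F r c b = ((q : ℂ) ^ r)⁻¹ * F r c (b + 1) := by
  have hq0 : (q : ℂ) ≠ 0 := by exact_mod_cast hq.1.ne'
  rw [t12star, map_neg, map_smul, matRep_tPol]
  simp only [tMat, LinearMap.neg_apply, LinearMap.smul_apply, LinearMap.coe_mk, AddHom.coe_mk,
    Pi.neg_apply, Pi.smul_apply, smul_eq_mul]
  field_simp
  ring

theorem matRep_t12star_pow (n : ℕ) (F : Mat) (r c : ℕ) (b : ℤ) :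
    (matRep hq (t12star q) ^ n) F r c b = ((q : ℂ) ^ r)⁻¹ ^ n * F r c (b + n) := by
  induction n generalizing F with
  | zero => simp
  | succ n ih =>
    rw [pow_succ, Module.End.mul_apply, ih, pow_succ, mul_assoc, matRep_t12star]
    simp [add_assoc]

theorem matRep_t11star_pow (n : ℕ) (F : Mat) (r c : ℕ) (b : ℤ) :
    (matRep hq (t11star q) ^ n) F r c b =
      (∏ j ∈ Finset.range n, shiftCoeff q (r + 1 + j)) * F (r + n) c b := by
  induction n generalizing F with
  | zero => simp
  | succ n ih =>
    rw [pow_succ, Module.End.mul_apply, ih, Finset.prod_range_succ, mul_assoc]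
    rw [t11star, map_neg, matRep_tPol]
    simp [tMat, add_right_comm, add_assoc]

theorem matRep_xPol (F : Mat) (r c : ℕ) (b : ℤ) :
    matRep hq (xPol q) F r c b = ((q : ℂ) ^ (2 * r))⁻¹ * F r c b := by
  rw [xPol, map_mul, Module.End.mul_apply, matRep_tPol]
  simp only [tMat, LinearMap.coe_mk, AddHom.coe_mk, matRep_t12star, two_mul, pow_add, mul_inv,
    sub_add_cancel, mul_assoc]

theorem matRep_aeval_xPol (p : Polynomial ℂ) (F : Mat) (r c : ℕ) (b : ℤ) :
    matRep hq (Polynomial.aeval (xPol q) p) F r c b =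
      p.eval (((q : ℂ) ^ (2 * r))⁻¹) * F r c b := by
  induction p using Polynomial.induction_on generalizing F with
  | C a => simp [AlgHom.commutes, Module.algebraMap_end_apply]
  | add p p' h h' => simp [h, h', add_mul]
  | monomial n a h =>
    rw [pow_succ, ← mul_assoc, map_mul, Polynomial.aeval_X, map_mul, Module.End.mul_apply, h,
      matRep_xPol,
      Polynomial.eval_mul_X (p := Polynomial.C a * Polynomial.X ^ n), mul_assoc]

/-- The normalization that relates the coefficient `ψ_i(q^{-2m})` to the matrix element with
indices `m + i₁`, `m + j₁`. -/
def nrm (q : ℝ) (i : Idx) (m : ℕ) : ℂ :=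
  -- The three factors come from `t₁₁^{i₁}` descending from row `m + i₁` to row `m`, from the phases
  -- acting on row `m`, and from `t₁₁*^{j₁}` ascending to row `m + j₁`.
  (∏ j ∈ Finset.range i.i₁, shiftCoeff q (m + i.i₁ - j)) * ((q : ℂ) ^ m)⁻¹ ^ (i.i₂ + i.j₂) *
    ∏ j ∈ Finset.range i.j₁, shiftCoeff q (m + 1 + j)

theorem nrm_ne_zero {q : ℝ} (hq : q ∈ Set.Ioo (0 : ℝ) 1) (i : Idx) (m : ℕ) : nrm q i m ≠ 0 := by
  have hq0 : (q : ℂ) ≠ 0 := by exact_mod_cast hq.1.ne'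
  refine mul_ne_zero (mul_ne_zero (Finset.prod_ne_zero_iff.mpr fun j hj => ?_) (by positivity))
    (Finset.prod_ne_zero_iff.mpr fun j _ => ?_)
  · have : m + i.i₁ - j = (m + i.i₁ - j - 1) + 1 := by have := Finset.mem_range.mp hj; omega
    rw [this]; exact shiftCoeff_succ_ne_zero hq _
  · rw [add_right_comm]; exact shiftCoeff_succ_ne_zero hq _

@[ext]
theorem Idx.ext {i i' : Idx} (h₁ : i.i₁ = i'.i₁) (h₂ : i.i₂ = i'.i₂) (h₃ : i.j₁ = i'.j₁)
    (h₄ : i.j₂ = i'.j₂) : i = i' := by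
  cases i; cases i'; simp_all

/-- In each of the pairs `(i₁, j₁)`, `(i₂, j₂)` one member vanishes, so the signed difference
recovers both. Distinct indices therefore occupy disjoint sets of matrix entries. -/
theorem Idx.eq_of_sub_eq {i i' : Idx} (h₁ : (i.i₁ : ℤ) - i.j₁ = i'.i₁ - i'.j₁)
    (h₂ : (i.i₂ : ℤ) - i.j₂ = i'.i₂ - i'.j₂) : i = i' := by
  have a := Nat.mul_eq_zero.mp i.h₁
  have b := Nat.mul_eq_zero.mp i.h₂
  have a' := Nat.mul_eq_zero.mp i'.h₁
  have b' := Nat.mul_eq_zero.mp i'.h₂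
  ext <;> omega

/-- The index of the coefficient that determines the matrix element `(r, c, b)`. -/
def Idx.ofEntry (r c : ℕ) (b : ℤ) : Idx where
  i₁ := r - c
  i₂ := b.toNat
  j₁ := c - r
  j₂ := (-b).toNat
  h₁ := by rw [Nat.mul_eq_zero]; omega
  h₂ := by rw [Nat.mul_eq_zero]; omega

/-- The coefficients of the distribution with a given matrix. -/
def ofMat (q : ℝ) : Mat →L[ℂ] Distr where
  toFun F i m := (nrm q i m)⁻¹ * F (m + i.i₁) (m + i.j₁) (i.i₂ - i.j₂)
  map_add' F G := by funext i m; simp [mul_add]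
  map_smul' a F := by funext i m; simp; ring
  cont := by
    refine continuous_pi fun i => continuous_pi fun m => ?_
    fun_prop

/-- The matrix of a distribution. -/
def toMat (q : ℝ) : Distr →L[ℂ] Mat where
  toFun f r c b := nrm q (Idx.ofEntry r c b) (min r c) * f (Idx.ofEntry r c b) (min r c)
  map_add' f g := by funext r c b; simp [mul_add]
  map_smul' a f := by funext r c b; simp; ring
  cont := by
    refine continuous_pi fun r => continuous_pi fun c => continuous_pi fun b => ?_
    fun_prop

theorem ofMat_apply (F : Mat) (i : Idx) (m : ℕ) :
    ofMat q F i m = (nrm q i m)⁻¹ * F (m + i.i₁) (m + i.j₁) (i.i₂ - i.j₂) := rfl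

theorem toMat_apply (f : Distr) (r c : ℕ) (b : ℤ) :
    toMat q f r c b = nrm q (Idx.ofEntry r c b) (min r c) * f (Idx.ofEntry r c b) (min r c) := rfl

theorem Idx.min_entry (i : Idx) (m : ℕ) : min (m + i.i₁) (m + i.j₁) = m := by
  have := Nat.mul_eq_zero.mp i.h₁
  omega

theorem Idx.ofEntry_entry (i : Idx) (m : ℕ) :
    Idx.ofEntry (m + i.i₁) (m + i.j₁) (i.i₂ - i.j₂) = i := by
  apply Idx.eq_of_sub_eq <;> simp only [Idx.ofEntry] <;> omega

theorem ofMat_toMat {q : ℝ} (hq : q ∈ Set.Ioo (0 : ℝ) 1) (f : Distr) : ofMat q (toMat q f) = f := by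
  funext i m
  rw [ofMat_apply, toMat_apply, Idx.ofEntry_entry, Idx.min_entry,
    inv_mul_cancel_left₀ (nrm_ne_zero hq i m)]

theorem toMat_ofMat {q : ℝ} (hq : q ∈ Set.Ioo (0 : ℝ) 1) (F : Mat) : toMat q (ofMat q F) = F := by
  funext r c b
  rw [toMat_apply, ofMat_apply, mul_inv_cancel_left₀ (nrm_ne_zero hq _ _)]
  congr 1 <;> simp only [Idx.ofEntry] <;> omega

/-- The distribution defined by a polynomial. -/
def polDistr : Pol q →ₗ[ℂ] Distr := (ofMat q).toLinearMap ∘ₗ polMat hq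

theorem polDistr_apply (f : Pol q) : polDistr hq f = ofMat q (polMat hq f) := rfl

theorem toMat_polDistr (f : Pol q) : toMat q (polDistr hq f) = polMat hq f :=
  toMat_ofMat hq _

theorem polDistr_monomial (i : Idx) (p : Polynomial ℂ) (i' : Idx) (m : ℕ) :
    polDistr hq (tPol q .t11 ^ i.i₁ * tPol q .t12 ^ i.i₂ * Polynomial.aeval (xPol q) p *
      t12star q ^ i.j₂ * t11star q ^ i.j₁) i' m =
    (Finsupp.single i p i').eval (((q : ℂ) ^ (2 * m))⁻¹) := by
  rw [polDistr_apply, ofMat_apply, polMat_apply]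
  simp only [map_mul, map_pow, Module.End.mul_apply, matRep_tPol, tMat_t11_pow, tMat_t12_pow,
    matRep_aeval_xPol, matRep_t12star_pow, matRep_t11star_pow, oneMat]
  rcases eq_or_ne i i' with rfl | h
  · have h1 : m + i.i₁ - i.i₁ = m := by omega
    have h2 : (i.i₂ : ℤ) - i.j₂ - i.i₂ + i.j₂ = 0 := by ring
    have hn := nrm_ne_zero hq i m
    rw [inv_mul_eq_iff_eq_mul₀ hn, h1, h2, nrm, Finsupp.single_eq_same]
    simp only [and_self, if_true, pow_add]
    ring
  · rw [Finsupp.single_eq_of_ne' h, Polynomial.eval_zero]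
    by_cases hr : i.i₁ ≤ m + i'.i₁
    · rw [if_neg]
      · simp
      · rintro ⟨h1, h2⟩
        exact h (Idx.eq_of_sub_eq (by omega) (by omega))
    -- Here `t₁₁` is applied more often than the row index allows, so the path passes through `s(0)
    -- = 0`.
    · rw [Finset.prod_eq_zero (i := m + i'.i₁) (by simp; omega) (by simp [shiftCoeff_zero])]
      simp

theorem polDistr_expand (ψ : Idx →₀ Polynomial ℂ) :
    polDistr hq (expand q ψ) = toDistr q ψ := by
  funext i m
  rw [expand, Finsupp.sum, map_sum, Finset.sum_apply, Finset.sum_apply]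
  simp only [polDistr_monomial]
  rw [← Polynomial.eval_finsetSum, toDistr, ← Finsupp.finsetSum_apply, ← Finsupp.sum,
    Finsupp.sum_single]

end Expansion

/-! ### Ordered monomials span the polynomials -/

section Spanning

theorem mul_pow_of_mul_eq_smul {A : Type*} [Ring A] [Algebra ℂ A] {x y : A} {c : ℂ}
    (h : x * y = c • (y * x)) (n : ℕ) : x * y ^ n = c ^ n • (y ^ n * x) := by
  induction n with
  | zero => simp
  | succ n ih =>
    rw [pow_succ, ← mul_assoc, ih, smul_mul_assoc, mul_assoc, h, mul_smul_comm, smul_smul,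
      mul_assoc, pow_succ]

variable {q : ℝ}

theorem t12star_eq_smul (q : ℝ) : t12star q = (-(q : ℂ)) • tPol q .t21 :=
  (neg_smul (q : ℂ) (tPol q .t21)).symm

theorem t11star_eq_smul (q : ℝ) : t11star q = (-1 : ℂ) • tPol q .t22 :=
  (neg_one_smul ℂ (tPol q .t22)).symm

theorem t11_mul_t12star :
    tPol q .t11 * t12star q = (q : ℂ) • (t12star q * tPol q .t11) := by
  rw [t12star_eq_smul, mul_smul_comm, (isQuantumSL2_tPol q).r3, smul_mul_assoc, smul_comm]

theorem commute_t12star_t12 : Commute (t12star q) (tPol q .t12) := by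
  rw [Commute, SemiconjBy, t12star_eq_smul, mul_smul_comm, (isQuantumSL2_tPol q).r5,
    smul_mul_assoc]

theorem t12_mul_t11 (hq0 : (q : ℂ) ≠ 0) :
    tPol q .t12 * tPol q .t11 = (q : ℂ)⁻¹ • (tPol q .t11 * tPol q .t12) := by
  rw [(isQuantumSL2_tPol q).r1, inv_smul_smul₀ hq0]

theorem t12star_mul_t11 (hq0 : (q : ℂ) ≠ 0) :
    t12star q * tPol q .t11 = (q : ℂ)⁻¹ • (tPol q .t11 * t12star q) := by
  rw [t11_mul_t12star, inv_smul_smul₀ hq0]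

theorem t11star_mul_t12 (hq0 : (q : ℂ) ≠ 0) :
    t11star q * tPol q .t12 = (q : ℂ)⁻¹ • (tPol q .t12 * t11star q) := by
  rw [t11star_eq_smul, mul_smul_comm, (isQuantumSL2_tPol q).r4, smul_mul_assoc,
    smul_comm (-1 : ℂ), inv_smul_smul₀ hq0]

theorem t11star_mul_t12star (hq0 : (q : ℂ) ≠ 0) :
    t11star q * t12star q = (q : ℂ)⁻¹ • (t12star q * t11star q) := by
  simp only [t11star_eq_smul, t12star_eq_smul, mul_smul_comm, smul_mul_assoc,
    (isQuantumSL2_tPol q).r2]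
  match_scalars
  field_simp

theorem t11_mul_t11star :
    tPol q .t11 * t11star q = tPol q .t12 * t12star q - 1 := by
  have h := sub_eq_iff_eq_add.mp (isQuantumSL2_tPol q).r7
  simp only [t11star_eq_smul, t12star_eq_smul, mul_smul_comm, h]
  module

theorem t11star_mul_t11 (hq0 : (q : ℂ) ≠ 0) :
    t11star q * tPol q .t11 = ((q : ℂ) ^ 2)⁻¹ • (tPol q .t12 * t12star q) - 1 := by
  have h := sub_eq_iff_eq_add.mp (isQuantumSL2_tPol q).r7
  have h' := eq_sub_of_add_eq' (sub_eq_iff_eq_add.mp (isQuantumSL2_tPol q).r6).symm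
  simp only [t11star_eq_smul, t12star_eq_smul, mul_smul_comm, smul_mul_assoc, h', h]
  match_scalars
  · ring
  · field_simp
    ring

/-- The span of the ordered monomials in `t₁₁`, `t₁₂`, `t₁₂*`, `t₁₁*` that do not contain both
`t₁₁` and `t₁₁*`. -/
def monomialSpan (q : ℝ) : Submodule ℂ (Pol q) :=
  Submodule.span ℂ
    ((Set.range fun n : ℕ × ℕ × ℕ =>
        tPol q .t11 ^ n.1 * (tPol q .t12 ^ n.2.1 * t12star q ^ n.2.2)) ∪
      Set.range fun n : ℕ × ℕ × ℕ => tPol q .t12 ^ n.2.1 * t12star q ^ n.2.2 * t11star q ^ n.1)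

theorem mem_monomialSpan_left (a i j : ℕ) :
    tPol q .t11 ^ a * (tPol q .t12 ^ i * t12star q ^ j) ∈ monomialSpan q :=
  Submodule.subset_span (Or.inl ⟨(a, i, j), rfl⟩)

theorem mem_monomialSpan_right (a i j : ℕ) :
    tPol q .t12 ^ i * t12star q ^ j * t11star q ^ a ∈ monomialSpan q :=
  Submodule.subset_span (Or.inr ⟨(a, i, j), rfl⟩)

theorem mul_mem_monomialSpan {y : Pol q}
    (hl : ∀ a i j : ℕ, y * (tPol q .t11 ^ a * (tPol q .t12 ^ i * t12star q ^ j)) ∈ monomialSpan q)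
    (hr : ∀ a i j : ℕ, y * (tPol q .t12 ^ i * t12star q ^ j * t11star q ^ a) ∈ monomialSpan q)
    {f : Pol q} (hf : f ∈ monomialSpan q) : y * f ∈ monomialSpan q := by
  have : monomialSpan q ≤ (monomialSpan q).comap (LinearMap.mulLeft ℂ y) := by
    rw [monomialSpan, Submodule.span_le]
    rintro _ (⟨⟨a, i, j⟩, rfl⟩ | ⟨⟨a, i, j⟩, rfl⟩)
    · exact hl a i j
    · exact hr a i j
  exact this hf

theorem t12_mul_mem (hq0 : (q : ℂ) ≠ 0) {f : Pol q} (hf : f ∈ monomialSpan q) :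
    tPol q .t12 * f ∈ monomialSpan q := by
  refine mul_mem_monomialSpan (fun a i j => ?_) (fun a i j => ?_) hf
  · rw [← mul_assoc, mul_pow_of_mul_eq_smul (t12_mul_t11 hq0), smul_mul_assoc, mul_assoc,
      ← mul_assoc (tPol q .t12), ← pow_succ']
    exact Submodule.smul_mem _ _ (mem_monomialSpan_left _ _ _)
  · rw [← mul_assoc, ← mul_assoc, ← pow_succ']
    exact mem_monomialSpan_right _ _ _

theorem t12star_mul_mem (hq0 : (q : ℂ) ≠ 0) {f : Pol q} (hf : f ∈ monomialSpan q) :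
    t12star q * f ∈ monomialSpan q := by
  refine mul_mem_monomialSpan (fun a i j => ?_) (fun a i j => ?_) hf
  · rw [← mul_assoc, mul_pow_of_mul_eq_smul (t12star_mul_t11 hq0), smul_mul_assoc, mul_assoc,
      ← mul_assoc (t12star q), (commute_t12star_t12.pow_right i).eq, mul_assoc, ← pow_succ']
    exact Submodule.smul_mem _ _ (mem_monomialSpan_left _ _ _)
  · rw [← mul_assoc, ← mul_assoc, (commute_t12star_t12.pow_right i).eq, mul_assoc (_ ^ i),
      ← pow_succ']
    exact mem_monomialSpan_right _ _ _

theorem t11_mul_mem {f : Pol q} (hf : f ∈ monomialSpan q) :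
    tPol q .t11 * f ∈ monomialSpan q := by
  refine mul_mem_monomialSpan (fun a i j => ?_) (fun a i j => ?_) hf
  · rw [← mul_assoc, ← pow_succ']
    exact mem_monomialSpan_left _ _ _
  · rcases a with _ | a
    · simpa using mem_monomialSpan_left (q := q) 1 i j
    -- Moving `t₁₁` to the right past the powers of `t₁₂` and `t₁₂*` costs `q^{i+j}`; then `t₁₁ t₁₁*
    -- = x - 1` removes the forbidden pair.
    · have h : tPol q .t11 * (tPol q .t12 ^ i * t12star q ^ j * t11star q ^ (a + 1)) =
          ((q : ℂ) ^ i * (q : ℂ) ^ j) •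
            (tPol q .t12 ^ (i + 1) * t12star q ^ (j + 1) * t11star q ^ a -
              tPol q .t12 ^ i * t12star q ^ j * t11star q ^ a) := by
        rw [← mul_assoc, ← mul_assoc, mul_pow_of_mul_eq_smul (isQuantumSL2_tPol q).r1,
          smul_mul_assoc, smul_mul_assoc, mul_assoc (_ ^ i),
          mul_pow_of_mul_eq_smul t11_mul_t12star, mul_smul_comm, smul_mul_assoc, smul_smul,
          pow_succ' (t11star q), mul_assoc (_ ^ i), mul_assoc (_ ^ j), ← mul_assoc (tPol q .t11),
          t11_mul_t11star, sub_mul, one_mul, mul_sub, mul_sub, ← mul_assoc (_ ^ i),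
          ← mul_assoc (_ ^ i), ← mul_assoc (_ ^ i * _), ← mul_assoc (_ ^ i * _),
          mul_assoc (_ ^ i), (commute_t12star_t12.pow_left j).eq, ← mul_assoc (_ ^ i), ← pow_succ,
          mul_assoc (_ ^ (i + 1)), ← pow_succ]
      rw [h]
      exact Submodule.smul_mem _ _
        (Submodule.sub_mem _ (mem_monomialSpan_right _ _ _) (mem_monomialSpan_right _ _ _))

theorem t11star_mul_mem (hq0 : (q : ℂ) ≠ 0) {f : Pol q} (hf : f ∈ monomialSpan q) :
    t11star q * f ∈ monomialSpan q := by
  have hr (a i j : ℕ) :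
      t11star q * (tPol q .t12 ^ i * t12star q ^ j * t11star q ^ a) ∈ monomialSpan q := by
    rw [← mul_assoc, ← mul_assoc, mul_pow_of_mul_eq_smul (t11star_mul_t12 hq0), smul_mul_assoc,
      smul_mul_assoc, mul_assoc (_ ^ i), mul_pow_of_mul_eq_smul (t11star_mul_t12star hq0),
      mul_smul_comm, smul_mul_assoc, ← mul_assoc, mul_assoc, ← pow_succ']
    exact Submodule.smul_mem _ _ (Submodule.smul_mem _ _ (mem_monomialSpan_right _ _ _))
  refine mul_mem_monomialSpan (fun a i j => ?_) hr hf
  rcases a with _ | a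
  · simpa using hr 0 i j
  -- The product `t₁₁* t₁₁ = q^{-2} x - 1` absorbs `t₁₁*` at once, leaving only left multiplications
  -- by `t₁₂` and `t₁₂*`, already treated.
  · rw [pow_succ', mul_assoc, ← mul_assoc, t11star_mul_t11 hq0, sub_mul, one_mul, smul_mul_assoc,
      mul_assoc]
    have h := mem_monomialSpan_left (q := q) a i j
    exact Submodule.sub_mem _
      (Submodule.smul_mem _ _ (t12_mul_mem hq0 (t12star_mul_mem hq0 h))) h

theorem monomialSpan_eq_top (hq0 : (q : ℂ) ≠ 0) : monomialSpan q = ⊤ := by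
  refine (Submodule.eq_top_iff').mpr fun f => ?_
  -- The span is a left ideal, since generators preserve it; it contains `1`, so it is everything.
  have key : ∀ g ∈ monomialSpan q, f * g ∈ monomialSpan q := by
    induction f using pol_induction with
    | halg c =>
      intro g hg
      rw [← Algebra.smul_def]
      exact Submodule.smul_mem _ _ hg
    | hgen t =>
      intro g hg
      cases t
      · exact t11_mul_mem hg
      · exact t12_mul_mem hq0 hg
      · have h : tPol q .t21 = (-(q : ℂ))⁻¹ • t12star q := by
          rw [t12star_eq_smul, inv_smul_smul₀ (neg_ne_zero.mpr hq0)]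
        rw [h, smul_mul_assoc]
        exact Submodule.smul_mem _ _ (t12star_mul_mem hq0 hg)
      · have h : tPol q .t22 = (-1 : ℂ) • t11star q := by
          rw [t11star_eq_smul, smul_smul]; norm_num
        rw [h, smul_mul_assoc]
        exact Submodule.smul_mem _ _ (t11star_mul_mem hq0 hg)
    | hmul x y hx hy =>
      intro g hg
      rw [mul_assoc]
      exact hx _ (hy _ hg)
    | hadd x y hx hy =>
      intro g hg
      rw [add_mul]
      exact Submodule.add_mem _ (hx _ hg) (hy _ hg)
  simpa using key 1 (by simpa using mem_monomialSpan_left (q := q) 0 0 0)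

theorem expand_add (ψ φ : Idx →₀ Polynomial ℂ) :
    expand q (ψ + φ) = expand q ψ + expand q φ :=
  Finsupp.sum_add_index' (by simp) (by simp [mul_add, add_mul])

theorem expand_smul (c : ℂ) (ψ : Idx →₀ Polynomial ℂ) :
    expand q (c • ψ) = c • expand q ψ := by
  rw [expand, Finsupp.sum_smul_index' (by simp), expand, Finsupp.smul_sum]
  simp

theorem expand_single (i : Idx) (p : Polynomial ℂ) :
    expand q (Finsupp.single i p) = tPol q .t11 ^ i.i₁ * tPol q .t12 ^ i.i₂ *
      Polynomial.aeval (xPol q) p * t12star q ^ i.j₂ * t11star q ^ i.j₁ :=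
  Finsupp.sum_single_index (by simp)

theorem t12_pow_mul_t12star_pow (i j : ℕ) :
    tPol q .t12 ^ i * t12star q ^ j =
      tPol q .t12 ^ (i - j) * xPol q ^ min i j * t12star q ^ (j - i) := by
  rw [xPol, commute_t12star_t12.symm.mul_pow, ← mul_assoc, ← pow_add, mul_assoc, ← pow_add]
  congr 2 <;> omega

/-- Pairing off `t₁₂` with `t₁₂*`, which commute, turns the common part of their powers into `x ^
min i j`, so a spanning monomial becomes a single term indexed by `M''`. -/
theorem expand_surjective (hq0 : (q : ℂ) ≠ 0) : Function.Surjective (expand q) := by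
  intro f
  have hf : f ∈ monomialSpan q := monomialSpan_eq_top hq0 ▸ Submodule.mem_top
  induction hf using Submodule.span_induction with
  | zero => exact ⟨0, Finsupp.sum_zero_index⟩
  | add x y _ _ hx hy =>
    obtain ⟨ψ, rfl⟩ := hx
    obtain ⟨φ, rfl⟩ := hy
    exact ⟨ψ + φ, expand_add ψ φ⟩
  | smul c x _ hx =>
    obtain ⟨ψ, rfl⟩ := hx
    exact ⟨c • ψ, expand_smul c ψ⟩
  | mem x hx =>
    have h (i j : ℕ) : (i - j) * (j - i) = 0 := by rw [Nat.mul_eq_zero]; omega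
    rcases hx with ⟨⟨a, i, j⟩, rfl⟩ | ⟨⟨a, i, j⟩, rfl⟩
    · exact ⟨Finsupp.single ⟨a, i - j, 0, j - i, mul_zero a, h i j⟩ (Polynomial.X ^ min i j), by
        simp [expand_single, t12_pow_mul_t12star_pow i j, mul_assoc]⟩
    · exact ⟨Finsupp.single ⟨0, i - j, a, j - i, zero_mul a, h i j⟩ (Polynomial.X ^ min i j), by
        simp [expand_single, t12_pow_mul_t12star_pow i j]⟩

end Spanning

/-! ### Extension by continuity and its uniqueness -/

section Extension

variable {q : ℝ} (hq : q ∈ Set.Ioo (0 : ℝ) 1)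

theorem exists_eval_eq {q : ℝ} (hq : q ∈ Set.Ioo (0 : ℝ) 1) (u : ℕ → ℂ) (N : ℕ) :
    ∃ p : Polynomial ℂ, ∀ m < N, p.eval (((q : ℂ) ^ (2 * m))⁻¹) = u m := by
  have hinj : Function.Injective fun m : ℕ => ((q : ℂ) ^ (2 * m))⁻¹ := by
    intro m n h
    have h1 : q ^ (2 * m) = q ^ (2 * n) := by exact_mod_cast inv_injective h
    have := pow_right_injective₀ hq.1 hq.2.ne h1
    omega
  exact ⟨Lagrange.interpolate (Finset.range N) _ u, fun m hm =>
    Lagrange.eval_interpolate_at_node u hinj.injOn (Finset.mem_range.mpr hm)⟩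

/-- Interpolate the first `N` values of each coefficient in a finite set of indices. Along the
directed set of such data every single value `f i m` is eventually attained exactly. -/
theorem denseRange_toDistr {q : ℝ} (hq : q ∈ Set.Ioo (0 : ℝ) 1) : DenseRange (toDistr q) := by
  classical
  intro f
  choose p hp using fun (i : Idx) (N : ℕ) => exists_eval_eq hq (f i) N
  let ψ (n : Finset Idx × ℕ) : Idx →₀ Polynomial ℂ := Finsupp.indicator n.1 fun i _ => p i n.2
  refine mem_closure_of_tendsto (f := fun n => toDistr q (ψ n)) (b := Filter.atTop) ?_
    (Filter.Eventually.of_forall fun n => ⟨_, rfl⟩)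
  refine tendsto_pi_nhds.mpr fun i => tendsto_pi_nhds.mpr fun m => ?_
  refine tendsto_const_nhds.congr' ?_
  filter_upwards [Filter.eventually_ge_atTop (({i} : Finset Idx), m + 1)] with n hn
  have hi : i ∈ n.1 := Finset.singleton_subset_iff.mp hn.1
  rw [toDistr, Finsupp.indicator_of_mem hi, hp i n.2 m hn.2]

theorem denseRange_polDistr : DenseRange (polDistr hq) :=
  (denseRange_toDistr hq).mono <| by
    rintro _ ⟨ψ, rfl⟩
    exact ⟨expand q ψ, polDistr_expand hq ψ⟩

/-- The operators on distributions that correspond to the generators of `U_q su(1,1)`. -/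
def uDistr (q : ℝ) (u : UGen) : Distr →L[ℂ] Distr := (ofMat q).comp ((uMat q u).comp (toMat q))

theorem uDistr_apply (u : UGen) (f : Distr) :
    uDistr q u f = ofMat q (uMat q u (toMat q f)) := rfl

/-- Stated on the free algebra, so that it can be used to show that the operators `uDistr` satisfy
the relations. -/
theorem lift_uDistr_polDistr (x : FreeAlgebra ℂ UGen) (f : Pol q) :
    FreeAlgebra.lift ℂ (uDistr q) x (polDistr hq f) =
      polDistr hq (FreeAlgebra.lift ℂ (polActionGen hq) x f) := by
  induction x using FreeAlgebra.induction generalizing f with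
  | grade0 c => simp [Algebra.algebraMap_eq_smul_one]
  | grade1 u =>
    rw [FreeAlgebra.lift_ι_apply, FreeAlgebra.lift_ι_apply, uDistr_apply, toMat_polDistr,
      uMat_polMat, polDistr_apply]
  | mul x y hx hy => rw [map_mul, map_mul, Module.End.mul_apply, ← hx, ← hy]; rfl
  | add x y hx hy =>
    simp only [map_add, add_apply, LinearMap.add_apply, hx, hy]

theorem polAction_mk (x : FreeAlgebra ℂ UGen) :
    polAction hq (RingQuot.mkAlgHom ℂ (URel q) x) = FreeAlgebra.lift ℂ (polActionGen hq) x := by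
  rw [polAction, RingQuot.liftAlgHom_mkAlgHom_apply]

/-- The representation of `U_q su(1,1)` in the space of distributions. -/
def distrAction : Uq q →ₐ[ℂ] (Distr →L[ℂ] Distr) :=
  RingQuot.liftAlgHom ℂ ⟨FreeAlgebra.lift ℂ (uDistr q), by
    intro x y h
    -- Both sides of a relation are continuous operators, so it suffices to compare them on the
    -- dense image of the polynomials, where the relation is known.
    refine ContinuousLinearMap.ext fun f => congrFun (DenseRange.equalizer
      (denseRange_polDistr hq) (ContinuousLinearMap.continuous _)
      (ContinuousLinearMap.continuous _) (funext fun g => ?_)) f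
    simp only [Function.comp_apply]
    rw [lift_uDistr_polDistr, lift_uDistr_polDistr, ← polAction_mk, ← polAction_mk,
      RingQuot.mkAlgHom_rel ℂ h]⟩

theorem distrAction_mk (x : FreeAlgebra ℂ UGen) :
    distrAction hq (RingQuot.mkAlgHom ℂ (URel q) x) = FreeAlgebra.lift ℂ (uDistr q) x := by
  rw [distrAction, RingQuot.liftAlgHom_mkAlgHom_apply]

theorem distrAction_polDistr (ξ : Uq q) (f : Pol q) :
    distrAction hq ξ (polDistr hq f) = polDistr hq (polAction hq ξ f) := by
  obtain ⟨x, rfl⟩ := RingQuot.mkAlgHom_surjective ℂ (URel q) ξ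
  rw [distrAction_mk, lift_uDistr_polDistr, polAction_mk]

theorem extendsPolAction_distrAction : ExtendsPolAction hq (distrAction hq) := by
  intro ξ ψ φ h
  rw [← polDistr_expand hq, ← polDistr_expand hq, distrAction_polDistr, h]

/-- The extension condition speaks only of expanded elements; surjectivity of `expand` supplies a
`φ` for every `ξ` and `ψ`, so both extensions are determined on a dense set. -/
theorem ExtendsPolAction.unique {ρ ρ' : Uq q →ₐ[ℂ] (Distr →L[ℂ] Distr)}
    (h : ExtendsPolAction hq ρ) (h' : ExtendsPolAction hq ρ') : ρ' = ρ := by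
  have hq0 : (q : ℂ) ≠ 0 := by exact_mod_cast hq.1.ne'
  refine AlgHom.ext fun ξ => ContinuousLinearMap.ext fun f => congrFun (DenseRange.equalizer
    (denseRange_toDistr hq) (ContinuousLinearMap.continuous _)
    (ContinuousLinearMap.continuous _) (funext fun ψ => ?_)) f
  obtain ⟨φ, hφ⟩ := expand_surjective hq0 (polAction hq ξ (expand q ψ))
  exact (h' ξ ψ φ hφ.symm).trans (h ξ ψ φ hφ.symm).symm

end Extension

/-! ### Finite functions and invariance of the integral -/

section Integral

/-- All nonzero entries of the matrix lie in a bounded region. -/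
def HasBoundedSupport (F : Mat) : Prop :=
  ∃ N : ℕ, ∀ r c b, F r c b ≠ 0 → r < N ∧ c < N ∧ b.natAbs < N

/-- Each generator moves every matrix index by at most one. -/
theorem HasBoundedSupport.uMat {F : Mat} (hF : HasBoundedSupport F) (q : ℝ) (u : UGen) :
    HasBoundedSupport (uMat q u F) := by
  obtain ⟨N, hN⟩ := hF
  refine ⟨N + 1, fun r c b h => ?_⟩
  rw [uMat_apply] at h
  cases u <;> simp only [uMatFun] at h
  · have := hN _ _ _ (right_ne_zero_of_mul h); omega
  · have h1 := right_ne_zero_of_mul h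
    by_cases h2 : F r (c + 1) (b + 1) = 0
    · have := hN (r - 1) c (b + 1) (fun h3 => h1 (by simp [h2, h3])); omega
    · have := hN _ _ _ h2; omega
  · have h1 := right_ne_zero_of_mul h
    by_cases h2 : F (r + 1) c (b - 1) = 0
    · have := hN r (c - 1) (b - 1) (fun h3 => h1 (by simp [h2, h3])); omega
    · have := hN _ _ _ h2; omega
  · have := hN _ _ _ (right_ne_zero_of_mul h); omega
  · have := hN _ _ _ (right_ne_zero_of_mul h); omega

theorem hasBoundedSupport_toMat (q : ℝ) {f : Distr} (hf : f ∈ FinFun) :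
    HasBoundedSupport (toMat q f) := by
  have hf' : {p : Idx × ℕ | f p.1 p.2 ≠ 0}.Finite := hf
  obtain ⟨N, hN⟩ := (hf'.image fun p : Idx × ℕ =>
    p.1.i₁ + p.1.i₂ + p.1.j₁ + p.1.j₂ + p.2).bddAbove
  refine ⟨N + 1, fun r c b h => ?_⟩
  rw [toMat_apply] at h
  have := hN ⟨(Idx.ofEntry r c b, min r c), right_ne_zero_of_mul h, rfl⟩
  simp only [Idx.ofEntry] at this
  omega

theorem HasBoundedSupport.ofMat_mem {F : Mat} (hF : HasBoundedSupport F) (q : ℝ) :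
    ofMat q F ∈ FinFun := by
  obtain ⟨N, hN⟩ := hF
  have hfin := ((Set.finite_Iio N).prod ((Set.finite_Iio N).prod (Set.finite_Ioo (-N : ℤ) N)))
  refine Set.Finite.of_finite_image (f := fun p : Idx × ℕ =>
    (p.2 + p.1.i₁, p.2 + p.1.j₁, (p.1.i₂ : ℤ) - p.1.j₂)) (hfin.subset ?_) ?_
  · rintro _ ⟨⟨i, m⟩, h, rfl⟩
    have : m + i.i₁ < N ∧ m + i.j₁ < N ∧ ((i.i₂ : ℤ) - i.j₂).natAbs < N :=
      hN _ _ _ (right_ne_zero_of_mul h)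
    simp only [Set.mem_prod, Set.mem_Iio, Set.mem_Ioo]
    omega
  -- The entry position determines `i` through the index differences, and then `m`.
  · rintro ⟨i, m⟩ _ ⟨i', m'⟩ _ h
    simp only [Prod.mk.injEq] at h
    have hi : i = i' := Idx.eq_of_sub_eq (by omega) (by omega)
    subst hi
    exact Prod.ext rfl (by simp only; omega)

theorem uDistr_mem (q : ℝ) (u : UGen) {f : Distr} (hf : f ∈ FinFun) : uDistr q u f ∈ FinFun :=
  ((hasBoundedSupport_toMat q hf).uMat q u).ofMat_mem q

theorem lift_uDistr_mem (q : ℝ) (x : FreeAlgebra ℂ UGen) {f : Distr} (hf : f ∈ FinFun) :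
    FreeAlgebra.lift ℂ (uDistr q) x f ∈ FinFun := by
  induction x using FreeAlgebra.induction generalizing f with
  | grade0 c =>
    simpa [Algebra.algebraMap_eq_smul_one] using FinFun.smul_mem c hf
  | grade1 u => rw [FreeAlgebra.lift_ι_apply]; exact uDistr_mem q u hf
  | mul x y hx hy => rw [map_mul]; exact hx (hy hf)
  | add x y hx hy => rw [map_add]; exact FinFun.add_mem (hx hf) (hy hf)

theorem nrm_idx0 (q : ℝ) (m : ℕ) : nrm q idx0 m = 1 := by simp [nrm, idx0]

theorem ofMat_idx0 (q : ℝ) (F : Mat) (m : ℕ) : ofMat q F idx0 m = F m m 0 := by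
  rw [ofMat_apply, nrm_idx0]
  simp [idx0]

/-- On the diagonal `X^±` give a difference of two neighbouring off-diagonal entries whose scalars
differ by one power of `q`; the weight `q^{-2m}` turns this into an exact difference in `m`. `H` and
`k^{±1}` have weight zero there, so `G = 0` works. -/
theorem diag_uMat_eq_sub {q : ℝ} (hq : q ∈ Set.Ioo (0 : ℝ) 1) {F : Mat}
    (hF : HasBoundedSupport F) (u : UGen) :
    ∃ G : ℕ → ℂ, G 0 = 0 ∧ (∃ N, ∀ n ≥ N, G n = 0) ∧ ∀ m,
      (uMat q u F m m 0 - counitGen u * F m m 0) * ((q : ℂ) ^ (2 * m))⁻¹ = G (m + 1) - G m := by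
  obtain ⟨N, hN⟩ := hF
  have h0 := qh_ne_zero hq
  have hzero {r c : ℕ} {b : ℤ} (h : ¬(r < N ∧ c < N ∧ b.natAbs < N)) : F r c b = 0 :=
    not_not.mp fun h' => h (hN r c b h')
  cases u
  · exact ⟨0, rfl, ⟨0, by simp⟩, by simp [uMat_apply, uMatFun, counitGen]⟩
  -- This is minus the second term of `X⁺` at `(m, m, 0)` times `q^{-2m}`, with `qh^{2m} = q^m`; the
  -- first term is then the same expression at `m + 1`.
  · refine ⟨fun m => kap q * (qh q)⁻¹ * ((q : ℂ) ^ m)⁻¹ * shiftCoeff q m * F (m - 1) m 1,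
      by simp [shiftCoeff_zero],
      ⟨N, fun n hn => by simp [hzero (r := n - 1) (c := n) (b := 1) (by omega)]⟩,
      fun m => ?_⟩
    simp [uMat_apply, uMatFun, counitGen, zpow_add₀ h0, zpow_sub₀ h0, qh_mul_self hq]
    field_simp
    ring
  · refine ⟨fun m => kap q * q * (qh q)⁻¹ * ((q : ℂ) ^ m)⁻¹ * shiftCoeff q m * F m (m - 1) (-1),
      by simp [shiftCoeff_zero],
      ⟨N, fun n hn => by simp [hzero (r := n) (c := n - 1) (b := -1) (by omega)]⟩,
      fun m => ?_⟩
    simp [uMat_apply, uMatFun, counitGen, zpow_add₀ h0, zpow_sub₀ h0, qh_mul_self hq]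
    field_simp
    ring
  · exact ⟨0, rfl, ⟨0, by simp⟩, by simp [uMat_apply, uMatFun, counitGen]⟩
  · exact ⟨0, rfl, ⟨0, by simp⟩, by simp [uMat_apply, uMatFun, counitGen]⟩

theorem tsum_succ_sub_eq_zero {G : ℕ → ℂ} (h0 : G 0 = 0) (hG : ∃ N, ∀ n ≥ N, G n = 0) :
    ∑' m, (G (m + 1) - G m) = 0 := by
  obtain ⟨N, hN⟩ := hG
  rw [tsum_eq_sum (s := Finset.range N), Finset.sum_range_sub, h0, hN N le_rfl, sub_zero]
  intro m hm
  have : N ≤ m := by simpa using hm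
  rw [hN _ (by omega), hN _ this, sub_zero]

theorem nu_uDistr {q : ℝ} (hq : q ∈ Set.Ioo (0 : ℝ) 1) (u : UGen) (f : FinFun) :
    nu q ⟨uDistr q u f, uDistr_mem q u f.2⟩ = counitGen u * nu q f := by
  rw [← sub_eq_zero, ← smul_eq_mul, ← map_smul, ← map_sub]
  obtain ⟨G, h0, hG, h⟩ := diag_uMat_eq_sub hq (hasBoundedSupport_toMat q f.2) u
  have hf (m : ℕ) : (f : Distr) idx0 m = toMat q f m m 0 := by
    rw [← ofMat_idx0 q (toMat q f), ofMat_toMat hq]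
  simp only [nu, LinearMap.coe_mk, AddHom.coe_mk, Submodule.coe_sub, Submodule.coe_smul,
    Pi.sub_apply, Pi.smul_apply, smul_eq_mul, uDistr_apply, ofMat_idx0, hf, h,
    tsum_succ_sub_eq_zero h0 hG, mul_zero]

variable {q : ℝ} (hq : q ∈ Set.Ioo (0 : ℝ) 1)

theorem distrAction_mem (ξ : Uq q) {f : Distr} (hf : f ∈ FinFun) :
    distrAction hq ξ f ∈ FinFun := by
  obtain ⟨x, rfl⟩ := RingQuot.mkAlgHom_surjective ℂ (URel q) ξ
  rw [distrAction_mk]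
  exact lift_uDistr_mem q x hf

/-- The representation of `U_q su(1,1)` in the space of finite functions. -/
def finFunAction : Uq q →ₐ[ℂ] Module.End ℂ FinFun :=
  AlgHom.ofLinearMap
    { toFun ξ := (distrAction hq ξ).toLinearMap.restrict fun _ hf => distrAction_mem hq ξ hf
      map_add' ξ η := by ext1 f; apply Subtype.ext; simp [LinearMap.restrict_apply]
      map_smul' c ξ := by ext1 f; apply Subtype.ext; simp [LinearMap.restrict_apply] }
    (by ext1 f; apply Subtype.ext; simp [LinearMap.restrict_apply])
    (fun ξ η => by ext1 f; apply Subtype.ext; simp [LinearMap.restrict_apply])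

theorem coe_finFunAction (ξ : Uq q) (f : FinFun) :
    (finFunAction hq ξ f : Distr) = distrAction hq ξ f := rfl

theorem counit_mk (x : FreeAlgebra ℂ UGen) :
    counit q (RingQuot.mkAlgHom ℂ (URel q) x) = FreeAlgebra.lift ℂ counitGen x := by
  rw [counit, RingQuot.liftAlgHom_mkAlgHom_apply]

/-- Invariance under generators suffices, because the counit is multiplicative and finite functions
are stable. -/
theorem isInvariantIntegral_nu : IsInvariantIntegral (finFunAction hq) (nu q) := by
  intro ξ f
  obtain ⟨x, rfl⟩ := RingQuot.mkAlgHom_surjective ℂ (URel q) ξ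
  induction x using FreeAlgebra.induction generalizing f with
  | grade0 c => simp [Algebra.algebraMap_eq_smul_one]
  | grade1 u =>
    rw [counit_mk, FreeAlgebra.lift_ι_apply, ← nu_uDistr hq]
    congr 1
    apply Subtype.ext
    rw [coe_finFunAction, distrAction_mk, FreeAlgebra.lift_ι_apply]
  | mul x y hx hy => simp only [map_mul, Module.End.mul_apply, hx, hy, mul_assoc]
  | add x y hx hy => simp only [map_add, LinearMap.add_apply, hx, hy, add_mul]

end Integral

end QuantumSU11

end

theorem proposition3p2 (q : ℝ) (hq : q ∈ Set.Ioo (0 : ℝ) 1) :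
    ∃ ρ : QuantumSU11.Uq q →ₐ[ℂ] (QuantumSU11.Distr →L[ℂ] QuantumSU11.Distr),
      QuantumSU11.ExtendsPolAction hq ρ ∧
      (∀ ρ' : QuantumSU11.Uq q →ₐ[ℂ] (QuantumSU11.Distr →L[ℂ] QuantumSU11.Distr),
        QuantumSU11.ExtendsPolAction hq ρ' → ρ' = ρ) ∧
      ∃ σ : QuantumSU11.Uq q →ₐ[ℂ] Module.End ℂ QuantumSU11.FinFun,
        (∀ (ξ : QuantumSU11.Uq q) (f : QuantumSU11.FinFun),
          ((σ ξ f : QuantumSU11.FinFun) : QuantumSU11.Distr) = ρ ξ (f : QuantumSU11.Distr)) ∧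
        QuantumSU11.IsInvariantIntegral σ (QuantumSU11.nu q) :=
  ⟨QuantumSU11.distrAction hq, QuantumSU11.extendsPolAction_distrAction hq,
    fun _ h => (QuantumSU11.extendsPolAction_distrAction hq).unique hq h,
    QuantumSU11.finFunAction hq, QuantumSU11.coe_finFunAction hq,
    QuantumSU11.isInvariantIntegral_nu hq⟩
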